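/- Notation. For a real matrix $\boldsymbol A$, $\|\boldsymbol A\|_F$ is the Frobenius norm; for a matrix-valued function, $\|\boldsymbol G\|_{L^p(\Omega)}$ is the $L^p(\Omega)$-norm (Lebesgue measure; essential supremum if $p=\infty$) of $\boldsymbol X\mapsto\|\boldsymbol G(\boldsymbol X)\|_F$. Let $d_x,n\ge 1$ be integers. For $\gamma\in(0,1]$ and $K_{\mathcal H}>0$, $\mathcal H^\gamma([0,1]^{d_x\times n},K_{\mathcal H})$ is the set of $f:[0,1]^{d_x\times n}\to\mathbb R$ with $\|f\|_{L^\infty}+\sup_{\boldsymbol X\ne \boldsymbol Y}|f(\boldsymbol X)-f(\boldsymbol Y)|/\|\boldsymbol X-\boldsymbol Y\|_F^\gamma\le K_{\mathcal H}$. Write $\sigma_S$ for the column-wise softmax, $\sigma_S[\boldsymbol A]_{i,j}=e^{A_{i,j}}/\sum_k e^{A_{k,j}}$, and $\sigma_R[x]=\max\{x,0\}$ (entrywise). The class $\mathcal T_{d_x,d_x}(D,H,S,W,L)$ consists of the functions $$\mathcal E_{out}\circ\mathcal F_L^{(FF)}\circ\mathcal F_L^{(SA)}\circ\cdots\circ\mathcal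 F_1^{(FF)}\circ\mathcal F_1^{(SA)}\circ\mathcal E_{in}:\ \mathbb R^{d_x\times n}\to\mathbb R^{d_x\times n},$$ where $\mathcal E_{in}(\boldsymbol X)=\boldsymbol E_{in}\boldsymbol X+\boldsymbol P$, $\mathcal E_{out}(\boldsymbol Y)=\boldsymbol E_{out}\boldsymbol Y$, $$\mathcal F_l^{(SA)}(\boldsymbol Z)=\boldsymbol Z+\sum_{h=1}^H\boldsymbol W^{(O)}_{h,l}\big(\boldsymbol W^{(V)}_{h,l}\boldsymbol Z\big)\,\sigma_S\big[(\boldsymbol W^{(K)}_{h,l}\boldsymbol Z)^\top(\boldsymbol W^{(Q)}_{h,l}\boldsymbol Z)\big],$$ $$\mathcal F_l^{(FF)}(\boldsymbol Z)=\boldsymbol Z+\boldsymbol W^{(2)}_l\sigma_R\big[\boldsymbol W^{(1)}_l\boldsymbol Z+\boldsymbol b^{(1)}_l\boldsymbol 1_n^\top\big]+\boldsymbol b^{(2)}_l\boldsymbol 1_n^\top,$$ with arbitrary real weights $\boldsymbol E_{in}\in\mathbb R^{D\times d_x}$, $\boldsymbol P\in\mathbb R^{D\times n}$, $\boldsymbol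 E_{out}\in\mathbb R^{d_x\times D}$, $\boldsymbol W^{(O)}_{h,l}\in\mathbb R^{D\times S}$, $\boldsymbol W^{(V)}_{h,l},\boldsymbol W^{(K)}_{h,l},\boldsymbol W^{(Q)}_{h,l}\in\mathbb R^{S\times D}$, $\boldsymbol W^{(1)}_l\in\mathbb R^{W\times D}$, $\boldsymbol W^{(2)}_l\in\mathbb R^{D\times W}$, $\boldsymbol b^{(1)}_l\in\mathbb R^W$, $\boldsymbol b^{(2)}_l\in\mathbb R^D$. **Theorem 1.** Let $\gamma\in(0,1]$ and $K_{\mathcal H}>0$, and let $\boldsymbol F:[0,1]^{d_x\times n}\to\mathbb R^{d_x\times n}$ satisfy $F_{i,j}\in\mathcal H^\gamma([0,1]^{d_x\times n},K_{\mathcal H})$ for all $i\in\{1,\dots,d_x\}$, $j\in\{1,\dots,n\}$. For any $\varepsilon\in(0,1)$ and $p\in[1,\infty]$ there exists a Transformer network $$\mathcal N\in\mathcal T_{d_x,d_x}\big(D=C_1,\ H=C_2,\ S=C_3,\ W=C_4\cdot\lceil\varepsilon^{-d_xn/\gamma}\rceil,\ L=C_5\big)$$ such that $$\|\mathcal N-\boldsymbol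 F\|_{L^p([0,1]^{d_x\times n})}\le 4(d_xn)^2K_{\mathcal H}\,\varepsilon,$$ where 1. $C_1=d_x$, $C_2=1$, $C_3=1$, $C_4=5n$ and $C_5=2$ if $p\in[1,\infty)$; 2. $C_1=5d_x3^{d_xn}$, $C_2=3^{d_xn}$, $C_3=1$, $C_4=5n3^{d_xn}$ and $C_5=2+2d_xn$ if $p=\infty$. -/

import Mathlib

open MeasureTheory
open scoped ENNReal Matrix

namespace TransformerApprox

noncomputable section

/-! Norms, the cube and the Hölder class -/

/-- Lebesgue measure on the space of real `m × n` matrices, entry by entry. -/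
instance matrixMeasureSpace (m n : ℕ) : MeasureSpace (Matrix (Fin m) (Fin n) ℝ) :=
  inferInstanceAs (MeasureSpace (Fin m → Fin n → ℝ))

/-- The Frobenius norm of a real matrix. -/
def frobeniusNorm {m n : ℕ} (A : Matrix (Fin m) (Fin n) ℝ) : ℝ :=
  (Matrix.frobeniusNormedAddCommGroup (m := Fin m) (n := Fin n) (α := ℝ)).toNorm.norm A

/-- The unit cube `[0,1]^{d × n}`. -/
def unitCube (d n : ℕ) : Set (Matrix (Fin d) (Fin n) ℝ) :=
  {X | ∀ i j, X i j ∈ Set.Icc (0 : ℝ) 1}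

/-- The Hölder class `H^γ(Ω, K)`: the real functions on `Ω` whose (essential) sup norm on `Ω` plus
Hölder seminorm on `Ω` is at most `K`. Functions on `Ω` are represented by functions on the whole
space, only the values on `Ω` being looked at. Both suprema are taken in `[0, ∞]`. -/
def holderClass {d n : ℕ} (Ω : Set (Matrix (Fin d) (Fin n) ℝ)) (γ K : ℝ) :
    Set (Matrix (Fin d) (Fin n) ℝ → ℝ) :=
  {f | eLpNorm f ∞ (volume.restrict Ω) +
      (⨆ X ∈ Ω, ⨆ Y ∈ Ω, ⨆ _ : X ≠ Y,
        ENNReal.ofReal (|f X - f Y| / frobeniusNorm (X - Y) ^ γ)) ≤ ENNReal.ofReal K}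

/-- The `L^p(Ω)`-norm of a matrix-valued function: the `L^p`-norm of its Frobenius norm
(the essential supremum if `p = ∞`), as an element of `[0, ∞]`. -/
def matrixLpNorm {d m n : ℕ} (p : ℝ≥0∞) (Ω : Set (Matrix (Fin d) (Fin n) ℝ))
    (G : Matrix (Fin d) (Fin n) ℝ → Matrix (Fin m) (Fin n) ℝ) : ℝ≥0∞ :=
  eLpNorm (fun X => frobeniusNorm (G X)) p (volume.restrict Ω)

/-! Transformer networks -/

/-- The column-wise softmax. -/
def softmax {m n : ℕ} (A : Matrix (Fin m) (Fin n) ℝ) : Matrix (Fin m) (Fin n) ℝ :=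
  Matrix.of fun i j => Real.exp (A i j) / ∑ k, Real.exp (A k j)

/-- The ReLU activation, entry by entry. -/
def relu {m n : ℕ} (A : Matrix (Fin m) (Fin n) ℝ) : Matrix (Fin m) (Fin n) ℝ :=
  A.map fun x => max x 0

/-- `b 1ₙᵀ`: the matrix all of whose `n` columns are `b`. -/
def repeatColumn {m : ℕ} (n : ℕ) (b : Fin m → ℝ) : Matrix (Fin m) (Fin n) ℝ :=
  Matrix.of fun i _ => b i

/-- The weights of one attention head: embedding dimension `D`, head size `S`. -/
structure AttentionHead (D S : ℕ) where
  WO : Matrix (Fin D) (Fin S) ℝ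
  WV : Matrix (Fin S) (Fin D) ℝ
  WK : Matrix (Fin S) (Fin D) ℝ
  WQ : Matrix (Fin S) (Fin D) ℝ

/-- The contribution `W_O (W_V Z) softmax[(W_K Z)ᵀ (W_Q Z)]` of one head. -/
def AttentionHead.apply {D S : ℕ} (h : AttentionHead D S) {n : ℕ}
    (Z : Matrix (Fin D) (Fin n) ℝ) : Matrix (Fin D) (Fin n) ℝ :=
  h.WO * (h.WV * Z) * softmax ((h.WK * Z)ᵀ * (h.WQ * Z))

/-- The parameters of one Transformer layer: a self-attention sublayer with `H` heads of size `S`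
followed by a feed-forward sublayer of hidden dimension `W`. -/
structure Layer (D H S W : ℕ) where
  heads : Fin H → AttentionHead D S
  W1 : Matrix (Fin W) (Fin D) ℝ
  b1 : Fin W → ℝ
  W2 : Matrix (Fin D) (Fin W) ℝ
  b2 : Fin D → ℝ

/-- The self-attention sublayer, with its skip connection. -/
def Layer.selfAttention {D H S W : ℕ} (l : Layer D H S W) {n : ℕ}
    (Z : Matrix (Fin D) (Fin n) ℝ) : Matrix (Fin D) (Fin n) ℝ :=
  Z + ∑ h, (l.heads h).apply Z

/-- The token-wise feed-forward sublayer, with its skip connection. -/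
def Layer.feedForward {D H S W : ℕ} (l : Layer D H S W) {n : ℕ}
    (Z : Matrix (Fin D) (Fin n) ℝ) : Matrix (Fin D) (Fin n) ℝ :=
  Z + l.W2 * relu (l.W1 * Z + repeatColumn n l.b1) + repeatColumn n l.b2

/-- The parameters of a Transformer network on sequences of `n` tokens, with input dimension `dx`,
output dimension `dy`, embedding dimension `D`, `H` heads of size `S`, feed-forward hidden
dimension `W` and `L` layers. -/
structure Transformer (n dx dy D H S W L : ℕ) where
  Ein : Matrix (Fin D) (Fin dx) ℝ
  P : Matrix (Fin D) (Fin n) ℝ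
  layers : Fin L → Layer D H S W
  Eout : Matrix (Fin dy) (Fin D) ℝ

/-- The function computed by a Transformer network: embedding `X ↦ E_in X + P`, then the layers
`0, …, L - 1` in this order, then the projection `Y ↦ E_out Y`. -/
def Transformer.eval {n dx dy D H S W L : ℕ} (T : Transformer n dx dy D H S W L)
    (X : Matrix (Fin dx) (Fin n) ℝ) : Matrix (Fin dy) (Fin n) ℝ :=
  T.Eout * (List.ofFn T.layers).foldl (fun Z l => l.feedForward (l.selfAttention Z))
    (T.Ein * X + T.P)

/-- The class `T_{dx,dy}(D, H, S, W, L)` of functions computed by Transformer networks on sequences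
of `n` tokens. -/
def transformerClass (n dx dy D H S W L : ℕ) :
    Set (Matrix (Fin dx) (Fin n) ℝ → Matrix (Fin dy) (Fin n) ℝ) :=
  Set.range (Transformer.eval (n := n) (dx := dx) (dy := dy) (D := D) (H := H) (S := S) (W := W)
    (L := L))

end

end TransformerApprox

open TransformerApprox

open Filter Topology

namespace TransformerApprox

/-! Softmax averages of exponentials -/

/-! Cut the cube into K^(dx n) cells with K = ⌊ε^(-1/γ)⌋ and replace F by its value at the grid
point of the cell. The Hölder bound makes this error at most 3 √(dx n) KH ε in each entry. It
remains to compute such a step function in two layers with one memorizing neuron per pair of cell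
and column.

The first feed-forward sublayer is a staircase that turns each column into an integer token. Entries
of column j are moved to [jK, (j+1)K] beforehand, so tokens of different columns never coincide. One
softmax head with scalar query, key and value then adds to the token a_j a multiple w of the mean of
all tokens with Boltzmann weights exp(c a_j a_k). Such means are derivatives of log-sum-exp;
analyticity and the linear independence of exponentials separate those of different cells at all
small nonzero parameters. Hence suitable c and w encode cell and column in one number
(`exists_contextId_injective`), and a shallow ReLU network takes prescribed values at these numbers
(`exists_relu_interpolation`).

A continuous staircase is wrong on ramps of width δ. The tokens on its flat parts do not depend on
δ, so the later weights do not either, and the outputs stay bounded as δ → 0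
(`exists_shifted_networks`). For p < ∞ a small δ pushes the contribution of the gaps below the spare
(dx n)² KH ε. For p = ∞, 3^(dx n) parallel copies shift every entry by 0, δ or 2δ. At most one of
the three shifts of an entry hits a gap, and medians taken in one entry after another remove the bad
copies (`exists_iterated_median_layers`). If K = 1, a constant network suffices. -/

theorem linearIndependent_exp_mul : LinearIndependent ℝ fun x t : ℝ => Real.exp (t * x) := by
  -- Each t ↦ exp(t x) is a character of the additive group ℝ, and distinct characters are linearly
  -- independent.
  let φ : ℝ → (Multiplicative ℝ →* ℝ) := fun x =>
    { toFun := fun t => Real.exp (t.toAdd * x)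
      map_one' := by simp
      map_mul' := fun s t => by simp [add_mul, Real.exp_add] }
  have hφ : Function.Injective φ := by
    intro x y h
    have := DFunLike.congr_fun h (Multiplicative.ofAdd 1)
    simpa [φ] using this
  exact (linearIndependent_monoidHom (Multiplicative ℝ) ℝ).comp φ hφ

/-- The exponent `a i₀` occurs once on the left and never on the right, so equality would put its
exponential in the span of the others. -/
theorem sum_exp_mul_ne {ι : Type*} [Fintype ι] {a b : ι → ℝ} {i₀ : ι}
    (ha : ∀ i, i ≠ i₀ → a i ≠ a i₀) (hb : ∀ i, b i ≠ a i₀) :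
    (fun t => ∑ i, Real.exp (t * a i)) ≠ fun t => ∑ i, Real.exp (t * b i) := by
  classical
  intro h
  have hmem : a i₀ ∉ {x | x ≠ a i₀} := by simp
  refine linearIndependent_exp_mul.notMem_span_image hmem ?_
  have key : (fun t => Real.exp (t * a i₀)) =
      ∑ i, (fun t => Real.exp (t * b i)) -
        ∑ i ∈ Finset.univ.erase i₀, fun t => Real.exp (t * a i) := by
    funext t
    have := congrFun h t
    beta_reduce at this
    rw [← Finset.add_sum_erase _ _ (Finset.mem_univ i₀)] at this
    simp only [Pi.sub_apply, Finset.sum_apply]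
    linarith
  rw [key]
  refine Submodule.sub_mem _ (Submodule.sum_mem _ fun i _ => ?_)
    (Submodule.sum_mem _ fun i hi => ?_)
  · exact Submodule.subset_span ⟨b i, hb i, rfl⟩
  · exact Submodule.subset_span ⟨a i, ha i (Finset.ne_of_mem_erase hi), rfl⟩

/-- The mean of the values `a i` with weights proportional to `exp (t * a i)`. -/
noncomputable def boltzmann {ι : Type*} [Fintype ι] (a : ι → ℝ) (t : ℝ) : ℝ :=
  (∑ i, a i * Real.exp (t * a i)) / ∑ i, Real.exp (t * a i)

theorem sum_exp_mul_pos {ι : Type*} [Fintype ι] [Nonempty ι] (a : ι → ℝ) (t : ℝ) :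
    0 < ∑ i, Real.exp (t * a i) :=
  Finset.sum_pos (fun _ _ => Real.exp_pos _) Finset.univ_nonempty

theorem analyticOnNhd_boltzmann {ι : Type*} [Fintype ι] [Nonempty ι] (a : ι → ℝ) :
    AnalyticOnNhd ℝ (boltzmann a) Set.univ := by
  intro t _
  refine AnalyticAt.div ?_ ?_ (sum_exp_mul_pos a t).ne'
  · exact Finset.analyticAt_fun_sum _ fun i _ => by fun_prop
  · exact Finset.analyticAt_fun_sum _ fun i _ => by fun_prop

theorem hasDerivAt_log_sum_exp_mul {ι : Type*} [Fintype ι] [Nonempty ι] (a : ι → ℝ) (t : ℝ) :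
    HasDerivAt (fun t => Real.log (∑ i, Real.exp (t * a i))) (boltzmann a t) t := by
  refine HasDerivAt.log ?_ (sum_exp_mul_pos a t).ne'
  refine HasDerivAt.fun_sum fun i _ => ?_
  have := ((hasDerivAt_id t).mul_const (a i)).exp
  simpa [mul_comm] using this

/-- An analytic difference without isolated zero at 0 vanishes identically. Then the log-sum-exps,
whose derivatives are the means, differ by a constant. -/
theorem eventually_boltzmann_ne {ι : Type*} [Fintype ι] {a b : ι → ℝ} {i₀ : ι}
    (ha : ∀ i, i ≠ i₀ → a i ≠ a i₀) (hb : ∀ i, b i ≠ a i₀) :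
    ∀ᶠ t in 𝓝[≠] (0 : ℝ), boltzmann a t ≠ boltzmann b t := by
  have : Nonempty ι := ⟨i₀⟩
  have han := (analyticOnNhd_boltzmann a).sub (analyticOnNhd_boltzmann b)
  rcases (han 0 (Set.mem_univ _)).eventually_eq_zero_or_eventually_ne_zero with h | h
  · exfalso
    have hz := han.eqOn_zero_of_preconnected_of_eventuallyEq_zero isPreconnected_univ
      (Set.mem_univ _) h
    have hd : ∀ t, HasDerivAt (fun t => Real.log (∑ i, Real.exp (t * a i)) -
        Real.log (∑ i, Real.exp (t * b i))) 0 t := fun t => by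
      have h0 : boltzmann a t - boltzmann b t = 0 := hz (Set.mem_univ t)
      rw [← h0]
      exact (hasDerivAt_log_sum_exp_mul a t).sub (hasDerivAt_log_sum_exp_mul b t)
    refine sum_exp_mul_ne ha hb (funext fun t => ?_)
    -- At t = 0 both sums count `ι`, so the constant is 0.
    have hc := is_const_of_deriv_eq_zero (fun t => (hd t).differentiableAt)
      (fun t => (hd t).deriv) t 0
    simp only [zero_mul, sub_self] at hc
    exact Real.log_injOn_pos (sum_exp_mul_pos a t) (sum_exp_mul_pos b t) (sub_eq_zero.mp hc)
  · filter_upwards [h] with t ht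
    exact sub_ne_zero.mp ht

theorem abs_boltzmann_le {ι : Type*} [Fintype ι] [Nonempty ι] {a : ι → ℝ} {A : ℝ}
    (hA : ∀ i, |a i| ≤ A) (t : ℝ) : |boltzmann a t| ≤ A := by
  have hpos := sum_exp_mul_pos a t
  rw [boltzmann, abs_div, abs_of_pos hpos, div_le_iff₀ hpos, Finset.mul_sum]
  refine (Finset.abs_sum_le_sum_abs _ _).trans (Finset.sum_le_sum fun i _ => ?_)
  rw [abs_mul, Real.abs_exp]
  exact mul_le_mul_of_nonneg_right (hA i) (Real.exp_nonneg _)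

/-- The scalar token `j` after a self-attention step with query scale `c` and value scale `w`. -/
noncomputable def contextId {n : ℕ} (c w : ℝ) (a : Fin n → ℝ) (j : Fin n) : ℝ :=
  a j + w * boltzmann a (c * a j)

theorem eventually_add_mul_ne_zero {x y : ℝ} (h : x ≠ 0 ∨ y ≠ 0) :
    ∀ᶠ w in 𝓝[≠] (0 : ℝ), x + w * y ≠ 0 := by
  by_cases hx : x = 0
  · filter_upwards [self_mem_nhdsWithin] with w hw
    simpa [hx] using ⟨hw, h.resolve_left (not_not.mpr hx)⟩
  · have : ContinuousAt (fun w => x + w * y) 0 := by fun_prop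
    exact (this.eventually_ne (by simpa using hx)).filter_mono nhdsWithin_le_nhds

/-- One self-attention head with suitable scales gives each token of each of finitely many
sequences its own value. -/
theorem exists_contextId_injective {ι : Type*} [Finite ι] {n : ℕ} (a : ι → Fin n → ℝ)
    (ha : Function.Injective a) (h0 : ∀ k j, a k j ≠ 0)
    (hpos : ∀ k j k' j', a k j = a k' j' → j = j') :
    ∃ c w : ℝ, Function.Injective fun q : ι × Fin n => contextId c w (a q.1) q.2 := by
  have hc : ∀ᶠ c in 𝓝[≠] (0 : ℝ), ∀ k k' : ι, ∀ j : Fin n, k ≠ k' →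
      boltzmann (a k) (c * a k j) ≠ boltzmann (a k') (c * a k j) := by
    simp only [eventually_all]
    intro k k' j hk
    obtain ⟨i₀, hi₀⟩ := Function.ne_iff.mp (ha.ne hk)
    have hev : ∀ᶠ t in 𝓝[≠] (0 : ℝ), boltzmann (a k) t ≠ boltzmann (a k') t := by
      refine eventually_boltzmann_ne (i₀ := i₀) (fun i hi h => hi (hpos _ _ _ _ h))
        fun i h => ?_
      obtain rfl := hpos _ _ _ _ h
      exact hi₀ h.symm
    -- Nonzero tokens are needed here: as `c` tends to 0 through nonzero values, so does `c * a k
    -- j`.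
    have ht : Tendsto (fun c : ℝ => c * a k j) (𝓝[≠] 0) (𝓝[≠] 0) := by
      refine tendsto_nhdsWithin_iff.mpr ⟨?_, ?_⟩
      · have : Tendsto (fun c : ℝ => c * a k j) (𝓝 0) (𝓝 (0 * a k j)) :=
          (continuous_id.mul continuous_const).tendsto 0
        rw [zero_mul] at this
        exact this.mono_left nhdsWithin_le_nhds
      · filter_upwards [self_mem_nhdsWithin] with c hc
        exact mul_ne_zero hc (h0 k j)
    exact ht.eventually hev
  obtain ⟨c, hc⟩ := hc.exists
  -- Different tokens stay apart for small `w`. Equal tokens force equal columns, hence different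
  -- sequences, whose means `c` separates.
  have hw : ∀ᶠ w in 𝓝[≠] (0 : ℝ), ∀ q q' : ι × Fin n, q ≠ q' →
      (a q.1 q.2 - a q'.1 q'.2) + w * (boltzmann (a q.1) (c * a q.1 q.2) -
        boltzmann (a q'.1) (c * a q'.1 q'.2)) ≠ 0 := by
    simp only [eventually_all]
    rintro ⟨k, j⟩ ⟨k', j'⟩ hq
    refine eventually_add_mul_ne_zero ?_
    by_cases hj : a k j = a k' j'
    · right
      rw [← hj]
      refine sub_ne_zero.mpr (hc k k' j ?_)
      rintro rfl
      exact hq (by rw [hpos _ _ _ _ hj])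
    · exact Or.inl (sub_ne_zero.mpr hj)
  obtain ⟨w, hw⟩ := hw.exists
  refine ⟨c, w, fun q q' h => ?_⟩
  by_contra hne
  refine hw q q' hne ?_
  simp only [contextId] at h
  linear_combination h

theorem abs_contextId_le {n : ℕ} (c w : ℝ) {a : Fin n → ℝ} {A : ℝ} (hA : ∀ i, |a i| ≤ A)
    (j : Fin n) : |contextId c w a j| ≤ A + |w| * A := by
  have : Nonempty (Fin n) := ⟨j⟩
  refine (abs_add_le _ _).trans (add_le_add (hA j) ?_)
  rw [abs_mul]
  exact mul_le_mul_of_nonneg_left (abs_boltzmann_le hA _) (abs_nonneg _)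

/-! Interpolation by shallow ReLU networks -/

/-- Points are added from left to right. The kink of the new neuron lies between the old points and
the new one, so it leaves the old values unchanged and its weight adjusts the new value. -/
theorem exists_relu_interpolation_finset {m : ℕ} (S : Finset ℝ) (f : ℝ → Fin m → ℝ) :
    ∃ (b : ℝ → ℝ) (u : ℝ → Fin m → ℝ),
      ∀ x ∈ S, ∀ i, ∑ y ∈ S, u y i * max (x - b y) 0 = f x i := by
  induction S using Finset.induction_on_max with
  | empty => exact ⟨0, 0, by simp⟩
  | insert a S ha ih =>
    obtain ⟨b, u, h⟩ := ih
    obtain ⟨β, hβa, hβ⟩ : ∃ β < a, ∀ x ∈ S, x ≤ β := by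
      rcases S.eq_empty_or_nonempty with rfl | hS
      · exact ⟨a - 1, by linarith, by simp⟩
      · exact ⟨S.max' hS, ha _ (S.max'_mem hS), fun x hx => S.le_max' x hx⟩
    have haS : a ∉ S := fun h => lt_irrefl _ (ha a h)
    refine ⟨Function.update b a β, Function.update u a fun i =>
      (f a i - ∑ y ∈ S, u y i * max (a - b y) 0) / (a - β), fun x hx i => ?_⟩
    have hsum : ∀ x, ∑ y ∈ S, Function.update u a (fun i =>
        (f a i - ∑ y ∈ S, u y i * max (a - b y) 0) / (a - β)) y i *
          max (x - Function.update b a β y) 0 = ∑ y ∈ S, u y i * max (x - b y) 0 := fun x =>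
      Finset.sum_congr rfl fun y hy => by
        have hya : y ≠ a := fun h => haS (h ▸ hy)
        rw [Function.update_of_ne hya, Function.update_of_ne hya]
    rw [Finset.sum_insert haS, hsum]
    simp only [Function.update_self]
    rcases Finset.mem_insert.mp hx with rfl | hx
    · have : 0 < x - β := by linarith
      rw [max_eq_left this.le]
      field_simp
      ring
    · rw [max_eq_right (by linarith [hβ x hx]), h x hx]
      ring

theorem exists_relu_interpolation {κ : Type*} [Fintype κ] {m : ℕ} (x : κ → ℝ)
    (hx : Function.Injective x) (f : κ → Fin m → ℝ) :
    ∃ (b : κ → ℝ) (u : κ → Fin m → ℝ),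
      ∀ k i, ∑ k', u k' i * max (x k - b k') 0 = f k i := by
  classical
  obtain ⟨b, u, h⟩ := exists_relu_interpolation_finset (Finset.univ.image x)
    (Function.extend x f 0)
  refine ⟨b ∘ x, u ∘ x, fun k i => ?_⟩
  have := h (x k) (Finset.mem_image_of_mem _ (Finset.mem_univ k)) i
  rwa [Finset.sum_image (fun _ _ _ _ h => hx h), hx.extend_apply] at this

/-! Layers acting on a chosen set of coordinates -/

section Steps

variable {I κ : Type*} [Fintype I] [Fintype κ] {n D H W : ℕ}

/-- A sum of attention heads of size one with query, key, value and output weights on the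
coordinates `I`, with skip connection. -/
noncomputable def attentionStep (wO wV wK wQ : Fin H → I → ℝ) (Y : I → Fin n → ℝ) :
    I → Fin n → ℝ := fun p j =>
  Y p j + ∑ h, wO h p * ((∑ k, (∑ q, wV h q * Y q k) *
    Real.exp ((∑ q, wK h q * Y q k) * ∑ q, wQ h q * Y q j)) /
      ∑ k, Real.exp ((∑ q, wK h q * Y q k) * ∑ q, wQ h q * Y q j))

/-- A feed-forward sublayer with hidden neurons `κ` on the coordinates `I`, with skip
connection. -/
noncomputable def feedForwardStep (w : κ → I → ℝ) (b : κ → ℝ) (u : κ → I → ℝ) (b₂ : I → ℝ)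
    (Y : I → Fin n → ℝ) : I → Fin n → ℝ := fun p j =>
  Y p j + ∑ k, u k p * max ((∑ q, w k q * Y q j) + b k) 0 + b₂ p

theorem sum_extend_mul (e : I ↪ Fin D) (g : I → ℝ) (z : Fin D → ℝ) :
    ∑ r, Function.extend e g 0 r * z r = ∑ q, g q * z (e q) := by
  refine (Fintype.sum_of_injective e e.injective _ _ (fun r hr => ?_) fun q => ?_).symm
  · rw [Function.extend_apply' _ _ _ (by simpa using hr)]
    simp
  · rw [e.injective.extend_apply]

/-- Weights are extended by zero along `e` and along an embedding of the neurons, so the remaining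
coordinates never feed into the chosen ones. -/
theorem exists_layer (e : I ↪ Fin D) (hκ : Fintype.card κ ≤ W)
    (wO wV wK wQ : Fin H → I → ℝ) (w : κ → I → ℝ) (b : κ → ℝ) (u : κ → I → ℝ) (b₂ : I → ℝ) :
    ∃ l : Layer D H 1 W, ∀ Z : Matrix (Fin D) (Fin n) ℝ,
      (fun p j => (l.feedForward (l.selfAttention Z)) (e p) j) =
        feedForwardStep w b u b₂ (attentionStep wO wV wK wQ fun p j => Z (e p) j) := by
  obtain ⟨ν⟩ : Nonempty (κ ↪ Fin W) :=
    Function.Embedding.nonempty_of_card_le (by simpa using hκ)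
  let l : Layer D H 1 W :=
    { heads := fun h =>
        { WO := Matrix.of fun r _ => Function.extend e (wO h) 0 r
          WV := Matrix.of fun _ r => Function.extend e (wV h) 0 r
          WK := Matrix.of fun _ r => Function.extend e (wK h) 0 r
          WQ := Matrix.of fun _ r => Function.extend e (wQ h) 0 r }
      W1 := Matrix.of fun t r => Function.extend ν (fun k => Function.extend e (w k) 0 r) 0 t
      b1 := Function.extend ν b 0
      W2 := Matrix.of fun r t => Function.extend ν (fun k => Function.extend e (u k) 0 r) 0 t
      b2 := Function.extend e b₂ 0 }
  have hatt : ∀ (Z : Matrix (Fin D) (Fin n) ℝ) p j, l.selfAttention Z (e p) j =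
      attentionStep wO wV wK wQ (fun p j => Z (e p) j) p j := fun Z p j => by
    simp only [Layer.selfAttention, AttentionHead.apply, softmax, attentionStep,
      Matrix.add_apply, Matrix.sum_apply, Matrix.mul_apply, Matrix.transpose_apply,
      Matrix.of_apply, Finset.univ_unique, Finset.sum_singleton, l, sum_extend_mul,
      e.injective.extend_apply]
    congr 1
    refine Finset.sum_congr rfl fun h _ => ?_
    rw [Finset.sum_div, Finset.mul_sum]
    exact Finset.sum_congr rfl fun k _ => by ring
  have hff : ∀ (Z : Matrix (Fin D) (Fin n) ℝ) p j, l.feedForward Z (e p) j =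
      feedForwardStep w b u b₂ (fun p j => Z (e p) j) p j := fun Z p j => by
    simp only [Layer.feedForward, feedForwardStep, relu, repeatColumn, Matrix.add_apply,
      Matrix.mul_apply, Matrix.map_apply, Matrix.of_apply, l, e.injective.extend_apply]
    congr 2
    refine (Fintype.sum_of_injective ν ν.injective _ _ (fun t ht => ?_) fun k => ?_).symm
    · rw [Function.extend_apply' _ _ _ (by simpa using ht)]
      simp
    · simp only [ν.injective.extend_apply, sum_extend_mul]
  refine ⟨l, fun Z => ?_⟩
  funext p j
  rw [hff]
  congr 1
  funext p j
  exact hatt Z p j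

theorem attentionStep_zero (wV wK wQ : Fin H → I → ℝ) (Y : I → Fin n → ℝ) :
    attentionStep 0 wV wK wQ Y = Y := by
  funext p j
  simp [attentionStep]

end Steps

/-! Quantization, contextual attention and memorization -/

/-- The continuous ramp from `0` to `1` on `[0, δ]`. -/
noncomputable def ramp (δ t : ℝ) : ℝ := (max t 0 - max (t - δ) 0) / δ

/-- The continuous staircase with ramps `[r + 1, r + 1 + δ]`, `r < R`. -/
noncomputable def quantize (δ : ℝ) (R : ℕ) (y : ℝ) : ℝ := ∑ r : Fin R, ramp δ (y - (r + 1))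

/-- The scalar encoding of a column by the digits `quantize δ R (y i)`. -/
noncomputable def token (δ : ℝ) (R : ℕ) {dx : ℕ} (y : Fin dx → ℝ) : ℝ :=
  1 + ∑ i : Fin dx, (R : ℝ) ^ (i : ℕ) * quantize δ R (y i)

theorem ramp_of_nonpos {δ t : ℝ} (hδ : 0 < δ) (ht : t ≤ 0) : ramp δ t = 0 := by
  rw [ramp, max_eq_right ht, max_eq_right (by linarith)]
  simp

theorem ramp_of_ge {δ t : ℝ} (hδ : 0 < δ) (ht : δ ≤ t) : ramp δ t = 1 := by
  rw [ramp, max_eq_left (by linarith), max_eq_left (by linarith)]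
  field_simp
  ring

theorem abs_ramp_le {δ : ℝ} (hδ : 0 < δ) (t : ℝ) : |ramp δ t| ≤ 1 := by
  rw [ramp, abs_div, abs_of_pos hδ, div_le_one hδ, abs_le]
  constructor <;> rcases max_cases t 0 with h | h <;> rcases max_cases (t - δ) 0 with h' | h' <;>
    linarith

theorem abs_quantize_le {δ : ℝ} (hδ : 0 < δ) (R : ℕ) (y : ℝ) : |quantize δ R y| ≤ R := by
  refine (Finset.abs_sum_le_sum_abs _ _).trans ?_
  refine (Finset.sum_le_sum fun r _ => abs_ramp_le hδ _).trans ?_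
  simp

theorem abs_token_le {δ : ℝ} (hδ : 0 < δ) (R : ℕ) {dx : ℕ} (y : Fin dx → ℝ) :
    |token δ R y| ≤ 1 + ∑ i : Fin dx, (R : ℝ) ^ (i : ℕ) * R := by
  refine (abs_add_le _ _).trans (add_le_add (by simp) ?_)
  refine (Finset.abs_sum_le_sum_abs _ _).trans (Finset.sum_le_sum fun i _ => ?_)
  rw [abs_mul, abs_of_nonneg (by positivity)]
  exact mul_le_mul_of_nonneg_left (abs_quantize_le hδ R _) (by positivity)

/-- The first `m` ramps are complete and the others have not begun. -/
theorem quantize_eq {δ : ℝ} (hδ : 0 < δ) {R m : ℕ} (hm : m < R) {y : ℝ}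
    (h₁ : m + δ ≤ y) (h₂ : y ≤ m + 1) : quantize δ R y = m := by
  have h : ∀ r : Fin R, ramp δ (y - (r + 1)) = if (r : ℕ) < m then 1 else 0 := fun r => by
    split_ifs with hr
    · have : (r : ℝ) + 1 ≤ m := by exact_mod_cast hr
      exact ramp_of_ge hδ (by linarith)
    · have : (m : ℝ) ≤ r := by exact_mod_cast not_lt.mp hr
      exact ramp_of_nonpos hδ (by linarith)
  rw [quantize, Finset.sum_congr rfl fun r _ => h r,
    Fin.sum_univ_eq_sum_range (fun r => if r < m then (1 : ℝ) else 0) R, Finset.sum_boole]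
  have : (Finset.range R).filter (· < m) = Finset.range m := by
    ext r
    simp only [Finset.mem_filter, Finset.mem_range]
    omega
  rw [this, Finset.card_range]

/-- The scalar code of a column of digits. -/
def columnCode (R : ℕ) {dx : ℕ} (m : Fin dx → Fin R) : ℕ := 1 + finFunctionFinEquiv m

theorem columnCode_injective (R dx : ℕ) :
    Function.Injective (columnCode R : (Fin dx → Fin R) → ℕ) := fun m m' h =>
  finFunctionFinEquiv.injective (Fin.ext (by simpa [columnCode] using h))

theorem token_eq {δ : ℝ} (hδ : 0 < δ) {R dx : ℕ} (m : Fin dx → Fin R) {y : Fin dx → ℝ}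
    (h₁ : ∀ i, (m i : ℕ) + δ ≤ y i) (h₂ : ∀ i, y i ≤ (m i : ℕ) + 1) :
    token δ R y = columnCode R m := by
  rw [token, columnCode, finFunctionFinEquiv_apply]
  push_cast
  congr 1
  exact Finset.sum_congr rfl fun i _ => by
    rw [quantize_eq hδ (m i).2 (h₁ i) (h₂ i), mul_comm]

section Blocks

variable {n dx H : ℕ} [NeZero dx]

/-- The state in which coordinate `0` of block `s` holds the scalars `a s` and all other
coordinates vanish. -/
def scalarState (a : Fin H → Fin n → ℝ) : Fin H × Fin dx → Fin n → ℝ := fun p j =>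
  if p.2 = 0 then a p.1 j else 0

/-- The biases of the neurons of the quantizer: one cancels the skip connection, the others come in
pairs, one pair for each ramp. -/
noncomputable def quantizeBias (δ : ℝ) (R : ℕ) : Option (Fin R × Bool) → ℝ
  | none => 0
  | some (r, false) => -((r : ℕ) + 1)
  | some (r, true) => -((r : ℕ) + 1) - δ

/-- The output weights of the neurons of the quantizer. -/
noncomputable def quantizeOutput (δ : ℝ) (R : ℕ) (q p : Fin H × Fin dx) :
    Option (Fin R × Bool) → ℝ
  | none => if q = p then -1 else 0
  | some (_, false) => if p.2 = 0 then if q.1 = p.1 then (R : ℝ) ^ (q.2 : ℕ) / δ else 0 else 0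
  | some (_, true) => if p.2 = 0 then if q.1 = p.1 then -((R : ℝ) ^ (q.2 : ℕ) / δ) else 0 else 0

/-- Nonnegativity makes ReLU the identity on the state, so one neuron per coordinate cancels the
skip connection. The output bias 1 is the leading 1 of the token. -/
theorem feedForwardStep_quantize (δ : ℝ) (R : ℕ) (Y : Fin H × Fin dx → Fin n → ℝ)
    (hY : ∀ p j, 0 ≤ Y p j) :
    feedForwardStep (κ := (Fin H × Fin dx) × Option (Fin R × Bool))
      (fun k q => if k.1 = q then 1 else 0) (fun k => quantizeBias δ R k.2)
      (fun k p => quantizeOutput δ R k.1 p k.2) (fun p => if p.2 = 0 then 1 else 0) Y =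
    scalarState fun s j => token δ R fun i => Y (s, i) j := by
  funext p j
  have hq : ∀ q : Fin H × Fin dx,
      (∑ q' : Fin H × Fin dx, (if q = q' then 1 else 0) * Y q' j) = Y q j := fun q => by simp
  simp only [feedForwardStep, scalarState, hq]
  rw [Fintype.sum_prod_type]
  have hinner : ∀ q : Fin H × Fin dx, (∑ o : Option (Fin R × Bool),
      quantizeOutput δ R q p o * max (Y q j + quantizeBias δ R o) 0) =
      (if q = p then -Y q j else 0) +
        if q.1 = p.1 then
          if p.2 = 0 then (R : ℝ) ^ (q.2 : ℕ) * quantize δ R (Y q j) else 0 else 0 := fun q => by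
    rw [Fintype.sum_option]
    congr 1
    · simp [quantizeOutput, quantizeBias, hY q j]
    · rw [Fintype.sum_prod_type]
      by_cases h₀ : p.2 = 0 <;> by_cases h₁ : q.1 = p.1 <;>
        simp only [quantizeOutput, quantizeBias, h₀, h₁, if_true, if_false, Fintype.sum_bool, zero_mul, add_zero,
          Finset.sum_const_zero]
      rw [quantize, Finset.mul_sum]
      refine Finset.sum_congr rfl fun r _ => ?_
      rw [ramp, ← sub_eq_add_neg, add_sub_assoc', ← sub_eq_add_neg]
      ring
  rw [Finset.sum_congr rfl fun q _ => hinner q, Finset.sum_add_distrib, Finset.sum_ite_eq',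
    if_pos (Finset.mem_univ p), Fintype.sum_prod_type]
  have houter : (∑ s : Fin H, ∑ i : Fin dx, if s = p.1 then
      if p.2 = 0 then (R : ℝ) ^ (i : ℕ) * quantize δ R (Y (s, i) j) else 0 else 0) =
      ∑ i : Fin dx, if p.2 = 0 then
        (R : ℝ) ^ (i : ℕ) * quantize δ R (Y (p.1, i) j) else 0 := by
    rw [Finset.sum_comm]
    simp
  simp only [houter]
  split_ifs with h₀
  · rw [token]
    ring
  · simp

/-- Head `s` reads and writes only coordinate 0 of block `s`, with scores `c` times the product of
two tokens. -/
theorem attentionStep_scalarState (c w : ℝ) (a : Fin H → Fin n → ℝ) :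
    attentionStep (fun h p => if p = (h, 0) then w else 0)
      (fun h q => if q = (h, 0) then 1 else 0)
      (fun h q => if q = (h, 0) then 1 else 0)
      (fun h q => if q = (h, 0) then c else 0) (scalarState (dx := dx) a) =
    scalarState fun s => contextId c w (a s) := by
  funext ⟨s, i⟩ j
  simp only [attentionStep, scalarState, ite_mul, one_mul, zero_mul, Finset.sum_ite_eq',
    Finset.mem_univ, if_true, Prod.mk.injEq, contextId, boltzmann]
  by_cases hi : i = 0
  · subst hi
    simp only [and_true, Finset.sum_ite_eq, Finset.mem_univ, if_true]
    simp only [mul_comm (c * a s j)]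
  · simp [hi]

theorem feedForwardStep_memorize {κ : Type*} [Fintype κ] (b : κ → ℝ) (u : κ → Fin dx → ℝ)
    (o : Fin H → Fin n → ℝ) :
    feedForwardStep (κ := Fin H × κ)
      (fun k q => if q = (k.1, 0) then 1 else 0) (fun k => -b k.2)
      (fun k p => if k.1 = p.1 then u k.2 p.2 else 0) 0 (scalarState o) =
    fun p j => (if p.2 = 0 then o p.1 j else 0) +
      ∑ k, u k p.2 * max (o p.1 j - b k) 0 := by
  funext ⟨s, i⟩ j
  simp only [feedForwardStep, scalarState, ite_mul, one_mul, zero_mul, Finset.sum_ite_eq',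
    Finset.mem_univ, if_true, Pi.zero_apply, add_zero, Fintype.sum_prod_type, ← sub_eq_add_neg]
  rw [Finset.sum_comm]
  simp

end Blocks

/-- The action of a Transformer layer. -/
noncomputable def layerMap {D H S W n : ℕ} (l : Layer D H S W) (Z : Matrix (Fin D) (Fin n) ℝ) :
    Matrix (Fin D) (Fin n) ℝ :=
  l.feedForward (l.selfAttention Z)

/-- The memorization map `o ↦ o e₀ + ∑ k, u k relu (o - b k)`, coordinate `i`. -/
noncomputable def memorize {dx : ℕ} [NeZero dx] {κ : Type*} [Fintype κ] (b : κ → ℝ)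
    (u : κ → Fin dx → ℝ) (i : Fin dx) (o : ℝ) : ℝ :=
  (if i = 0 then o else 0) + ∑ k, u k i * max (o - b k) 0

theorem exists_bound_memorize {dx : ℕ} [NeZero dx] {κ : Type*} [Fintype κ] (b : κ → ℝ)
    (u : κ → Fin dx → ℝ) (A : ℝ) : ∃ B, ∀ i o, |o| ≤ A → |memorize b u i o| ≤ B := by
  have h : ∀ i : Fin dx, ∃ B, ∀ o, |o| ≤ A → |memorize b u i o| ≤ B := fun i => by
    have hc : Continuous (memorize b u i) := by
      unfold memorize
      split_ifs <;> fun_prop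
    obtain ⟨B, hB⟩ := isCompact_Icc.exists_bound_of_continuousOn (s := Set.Icc (-A) A)
      hc.continuousOn
    exact ⟨B, fun o ho => hB o (abs_le.mp ho)⟩
  choose B hB using h
  exact ⟨∑ i, |B i|, fun i o ho => ((hB i o ho).trans (le_abs_self _)).trans
    (Finset.single_le_sum (fun i _ => abs_nonneg (B i)) (Finset.mem_univ i))⟩

/-- `H` parallel copies of the quantize, attend and memorize network, in two layers. -/
theorem exists_parallel_networks {dx n D H W R : ℕ} [NeZero dx] {κ : Type*} [Fintype κ]
    (e : Fin H × Fin dx ↪ Fin D) (h₁ : H * dx * (2 * R + 1) ≤ W) (h₂ : H * Fintype.card κ ≤ W)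
    (b : κ → ℝ) (u : κ → Fin dx → ℝ) (c w δ α : ℝ) (θ : Fin H → Fin dx → Fin n → ℝ) :
    ∃ (Ein : Matrix (Fin D) (Fin dx) ℝ) (P : Matrix (Fin D) (Fin n) ℝ) (l₁ l₂ : Layer D H 1 W),
      ∀ X : Matrix (Fin dx) (Fin n) ℝ, (∀ s i j, 0 ≤ α * X i j + θ s i j) → ∀ s i j,
        layerMap l₂ (layerMap l₁ (Ein * X + P)) (e (s, i)) j =
          memorize b u i (contextId c w
            (fun j => token δ R fun i => α * X i j + θ s i j) j) := by
  obtain ⟨l₁, hl₁⟩ := exists_layer (n := n) (H := H) (W := W) e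
    (κ := (Fin H × Fin dx) × Option (Fin R × Bool))
    (by simp only [Fintype.card_prod, Fintype.card_option, Fintype.card_fin, Fintype.card_bool]
        rwa [mul_comm R]) 0 0 0 0
      (fun k q => if k.1 = q then 1 else 0)
      (fun k => quantizeBias δ R k.2) (fun k p => quantizeOutput δ R k.1 p k.2)
      (fun p => if p.2 = 0 then 1 else 0)
  obtain ⟨l₂, hl₂⟩ := exists_layer (n := n) (H := H) (W := W) e (κ := Fin H × κ)
    (by simpa using h₂)
    (fun h p => if p = (h, 0) then w else 0) (fun h q => if q = (h, 0) then 1 else 0)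
    (fun h q => if q = (h, 0) then 1 else 0) (fun h q => if q = (h, 0) then c else 0)
    (fun k q => if q = (k.1, 0) then 1 else 0) (fun k => -b k.2)
    (fun k p => if k.1 = p.1 then u k.2 p.2 else 0) 0
  -- Every block receives the whole scaled input; the blocks differ only in the shift carried by the
  -- positional matrix.
  refine ⟨Matrix.of (Function.extend e (fun p i => if i = p.2 then α else 0) 0),
    Matrix.of (Function.extend e (fun p => θ p.1 p.2) 0), l₁, l₂, fun X hX s i j => ?_⟩
  have h0 : (fun p j => (Matrix.of (Function.extend e
      (fun (p : Fin H × Fin dx) i => if i = p.2 then α else 0) 0) * X +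
      Matrix.of (Function.extend e (fun p => θ p.1 p.2) 0)) (e p) j) =
      fun p j => α * X p.2 j + θ p.1 p.2 j := by
    funext p j
    simp [Matrix.mul_apply, e.injective.extend_apply]
  have := congrFun₂ (hl₂ (layerMap l₁ (Matrix.of (Function.extend e
      (fun (p : Fin H × Fin dx) i => if i = p.2 then α else 0) 0) * X +
      Matrix.of (Function.extend e (fun p => θ p.1 p.2) 0)))) (s, i) j
  refine this.trans ?_
  unfold layerMap
  rw [hl₁, h0, attentionStep_zero, feedForwardStep_quantize _ _ _ (fun p j => hX p.1 p.2 j),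
    attentionStep_scalarState, feedForwardStep_memorize]
  rfl

/-- The digit in row `i` and column `j` of a cell `k` of the grid, shifted according to the
column. -/
def cellDigit {dx n K : ℕ} (k : Fin dx → Fin n → Fin K) (j : Fin n) (i : Fin dx) : Fin (n * K) :=
  finProdFinEquiv (j, k i j)

theorem exists_memorize_grid {dx n : ℕ} [NeZero dx] (K : ℕ)
    (G : (Fin dx → Fin n → Fin K) → Fin dx → Fin n → ℝ) :
    ∃ (c w : ℝ) (b : (Fin dx → Fin n → Fin K) × Fin n → ℝ)
      (u : (Fin dx → Fin n → Fin K) × Fin n → Fin dx → ℝ), ∀ k i j,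
        memorize b u i (contextId c w (fun j => (columnCode (n * K) (cellDigit k j) : ℝ)) j) =
          G k i j := by
  have hdig : ∀ (k k' : Fin dx → Fin n → Fin K) j j',
      (columnCode (n * K) (cellDigit k j) : ℝ) = columnCode (n * K) (cellDigit k' j') →
        j = j' ∧ ∀ i, k i j = k' i j' := fun k k' j j' h => by
    have h' := columnCode_injective _ _ (Nat.cast_injective h)
    have h'' : ∀ i, (j, k i j) = (j', k' i j') := fun i =>
      finProdFinEquiv.injective (congrFun h' i)
    exact ⟨congrArg Prod.fst (h'' 0), fun i => congrArg Prod.snd (h'' i)⟩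
  obtain ⟨c, w, hcw⟩ := exists_contextId_injective
    (fun (k : Fin dx → Fin n → Fin K) j => (columnCode (n * K) (cellDigit k j) : ℝ))
    (fun k k' h => by
      funext i j
      exact (hdig k k' j j (congrFun h j)).2 i)
    (fun k j => by
      rw [columnCode]
      positivity)
    (fun k j k' j' h => (hdig k k' j j' h).1)
  -- The skip connection will add the identifier to row 0, so it is subtracted from the target
  -- there.
  obtain ⟨b, u, hbu⟩ := exists_relu_interpolation _ hcw fun q i =>
    G q.1 i q.2 - if i = 0 then
      contextId c w (fun j => (columnCode (n * K) (cellDigit q.1 j) : ℝ)) q.2 else 0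
  refine ⟨c, w, b, u, fun k i j => ?_⟩
  rw [memorize, hbu (k, j) i]
  ring

/-- The reals at which a staircase with ramps of width `δ` is flat. -/
def IsFlat (δ y : ℝ) : Prop := ∃ m : ℕ, m + δ ≤ y ∧ y ≤ m + 1

/-- The embedding of an entry `x` of column `j`, with shift `v`. -/
noncomputable def embedEntry (K : ℕ) (δ v : ℝ) (j : ℕ) (x : ℝ) : ℝ :=
  (K - 3 * δ) * x + (j * K + δ + v * δ)

/-- The slope K - 3δ leaves room for the offset δ and a shift of up to 2δ. -/
theorem embedEntry_mem_Icc {K : ℕ} (hK : 0 < K) {δ v : ℝ} (hδ : δ ∈ Set.Ioc (0 : ℝ) (1 / 4))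
    (hv : v ∈ Set.Icc (0 : ℝ) 2) (j : ℕ) {x : ℝ} (hx : x ∈ Set.Icc (0 : ℝ) 1) :
    embedEntry K δ v j x ∈ Set.Icc (j * K + δ) (j * K + K) := by
  have hK1 : (1 : ℝ) ≤ K := by exact_mod_cast hK
  have h₁ := mul_nonneg (show 0 ≤ (K : ℝ) - 3 * δ by linarith [hδ.2]) hx.1
  have h₂ := mul_nonneg (show 0 ≤ (K : ℝ) - 3 * δ by linarith [hδ.2]) (sub_nonneg.mpr hx.2)
  have h₃ := mul_nonneg hv.1 hδ.1.le
  have h₄ := mul_nonneg (sub_nonneg.mpr hv.2) hδ.1.le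
  constructor <;> unfold embedEntry <;> nlinarith

/-- Shrinking and shifting move Kx by at most 2δ ≤ 1/2 beyond its cell of length 1, hence the
constant 3/2. -/
theorem exists_cell_of_isFlat {K : ℕ} (hK : 0 < K) {δ v : ℝ} (hδ : δ ∈ Set.Ioc (0 : ℝ) (1 / 4))
    (hv : v ∈ Set.Icc (0 : ℝ) 2) {j : ℕ} {x : ℝ} (hx : x ∈ Set.Icc (0 : ℝ) 1)
    (h : IsFlat δ (embedEntry K δ v j x)) :
    ∃ k : Fin K, ((k + K * j : ℕ) : ℝ) + δ ≤ embedEntry K δ v j x ∧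
      embedEntry K δ v j x ≤ ((k + K * j : ℕ) : ℝ) + 1 ∧ |x - k / K| ≤ 3 / 2 / K := by
  obtain ⟨m, hm₁, hm₂⟩ := h
  have hy := embedEntry_mem_Icc hK hδ hv j hx
  have hδ0 := hδ.1
  have hjm : K * j ≤ m := by
    have : ((K * j : ℕ) : ℝ) < (m + 1 : ℕ) := by
      push_cast
      linarith [hy.1]
    exact Nat.lt_succ_iff.mp (by exact_mod_cast this)
  have hmj : m < K * j + K := by
    have : (m : ℝ) < (K * j + K : ℕ) := by
      push_cast
      linarith [hy.2]
    exact_mod_cast this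
  have hkm : m - K * j + K * j = m := Nat.sub_add_cancel hjm
  refine ⟨⟨m - K * j, by omega⟩, ?_, ?_, ?_⟩
  · simp only [hkm]
    exact hm₁
  · simp only [hkm]
    exact hm₂
  · have hKp : (0 : ℝ) < K := by exact_mod_cast hK
    have hcast : ((m - K * j : ℕ) : ℝ) = m - K * j := by
      rw [Nat.cast_sub hjm]
      push_cast
      rfl
    rw [hcast, le_div_iff₀ hKp, ← abs_of_pos hKp, ← abs_mul, abs_of_pos hKp, sub_mul,
      div_mul_cancel₀ _ hKp.ne', abs_le]
    have h₁ := mul_nonneg hδ0.le hx.1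
    have h₂ := mul_nonneg hδ0.le (sub_nonneg.mpr hx.2)
    have h₃ := mul_nonneg hv.1 hδ0.le
    have h₄ := mul_nonneg (sub_nonneg.mpr hv.2) hδ0.le
    unfold embedEntry at hm₁ hm₂
    constructor <;> nlinarith [hδ.2]

/-- Two-layer networks which, on `H` shifted copies of the input, take prescribed values `G k` on
the flat parts of the cells `k` of a grid, and are bounded independently of the width `δ` of the
gaps between these parts. -/
theorem exists_shifted_networks {dx n K : ℕ} [NeZero dx] (hK : 0 < K)
    (G : (Fin dx → Fin n → Fin K) → Fin dx → Fin n → ℝ) :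
    ∃ B : ℝ, ∀ δ ∈ Set.Ioc (0 : ℝ) (1 / 4), ∀ {D H W : ℕ} (e : Fin H × Fin dx ↪ Fin D),
      H * dx * (2 * (n * K) + 1) ≤ W → H * (K ^ (dx * n) * n) ≤ W →
      ∀ v : Fin H → Fin dx → Fin n → ℝ, (∀ s i j, v s i j ∈ Set.Icc (0 : ℝ) 2) →
      ∃ (Ein : Matrix (Fin D) (Fin dx) ℝ) (P : Matrix (Fin D) (Fin n) ℝ)
        (l₁ l₂ : Layer D H 1 W), ∀ X ∈ unitCube dx n, ∀ s,
        (∀ i j, |layerMap l₂ (layerMap l₁ (Ein * X + P)) (e (s, i)) j| ≤ B) ∧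
        ((∀ i j, IsFlat δ (embedEntry K δ (v s i j) j (X i j))) →
          ∃ k : Fin dx → Fin n → Fin K, (∀ i j, |X i j - k i j / K| ≤ 3 / 2 / K) ∧
            ∀ i j, layerMap l₂ (layerMap l₁ (Ein * X + P)) (e (s, i)) j = G k i j) := by
  -- The attention scales and memorizing weights are fixed before δ is given; this makes `B` uniform
  -- in δ.
  obtain ⟨c, w, b, u, hG⟩ := exists_memorize_grid K G
  set A : ℝ := 1 + ∑ i : Fin dx, ((n * K : ℕ) : ℝ) ^ (i : ℕ) * (n * K : ℕ)
  obtain ⟨B, hB⟩ := exists_bound_memorize b u (A + |w| * A)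
  refine ⟨B, fun δ hδ D H W e h₁ h₂ v hv => ?_⟩
  obtain ⟨Ein, P, l₁, l₂, hl⟩ := exists_parallel_networks (n := n) e h₁ (W := W)
    (κ := (Fin dx → Fin n → Fin K) × Fin n)
    (by simpa [← pow_mul, mul_comm n dx] using h₂) b u c w δ (K - 3 * δ)
    (fun s i j => j * K + δ + v s i j * δ)
  refine ⟨Ein, P, l₁, l₂, fun X hX s => ?_⟩
  have hl' := hl X fun s i j => by
    have := (embedEntry_mem_Icc hK hδ (hv s i j) j (hX i j)).1
    have h' : (0 : ℝ) ≤ j * K + δ := add_nonneg (by positivity) hδ.1.le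
    exact h'.trans this
  refine ⟨fun i j => ?_, fun hflat => ?_⟩
  · rw [hl']
    exact hB _ _ (abs_contextId_le _ _ (fun _ => abs_token_le hδ.1 _ _) _)
  · choose k hk using fun i j => exists_cell_of_isFlat hK hδ (hv s i j) (hX i j) (hflat i j)
    refine ⟨k, fun i j => (hk i j).2.2, fun i j => ?_⟩
    rw [hl', ← hG k i j]
    congr 2
    funext j
    exact token_eq hδ.1 (cellDigit k j) (fun i => (hk i j).1) fun i => (hk i j).2.1

/-! Hölder estimates -/

theorem frobeniusNorm_eq_sqrt {m n : ℕ} (A : Matrix (Fin m) (Fin n) ℝ) :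
    frobeniusNorm A = √(∑ i, ∑ j, A i j ^ 2) := by
  rw [frobeniusNorm, Real.sqrt_eq_rpow]
  refine (Matrix.frobenius_norm_def A).trans ?_
  simp

theorem frobeniusNorm_nonneg {m n : ℕ} (A : Matrix (Fin m) (Fin n) ℝ) : 0 ≤ frobeniusNorm A := by
  rw [frobeniusNorm_eq_sqrt]
  exact Real.sqrt_nonneg _

theorem frobeniusNorm_le {m n : ℕ} {A : Matrix (Fin m) (Fin n) ℝ} {c : ℝ} (hc : 0 ≤ c)
    (h : ∀ i j, |A i j| ≤ c) : frobeniusNorm A ≤ √(m * n) * c := by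
  rw [frobeniusNorm_eq_sqrt, Real.sqrt_le_iff]
  refine ⟨by positivity, ?_⟩
  rw [mul_pow, Real.sq_sqrt (by positivity)]
  have : ∑ i, ∑ j, A i j ^ 2 ≤ ∑ _i : Fin m, ∑ _j : Fin n, c ^ 2 :=
    Finset.sum_le_sum fun i _ => Finset.sum_le_sum fun j _ => sq_le_sq.mpr (by
      rw [abs_of_nonneg hc]
      exact h i j)
  refine this.trans_eq ?_
  simp
  ring

theorem frobeniusNorm_sub_pos {m n : ℕ} {X Y : Matrix (Fin m) (Fin n) ℝ} (h : X ≠ Y) :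
    0 < frobeniusNorm (X - Y) :=
  letI := Matrix.frobeniusNormedAddCommGroup (m := Fin m) (n := Fin n) (α := ℝ)
  norm_pos_iff.mpr (sub_ne_zero.mpr h)

theorem abs_sub_le_of_mem_holderClass {d n : ℕ} {Ω : Set (Matrix (Fin d) (Fin n) ℝ)} {γ K : ℝ}
    (hK : 0 ≤ K) {f : Matrix (Fin d) (Fin n) ℝ → ℝ} (hf : f ∈ holderClass Ω γ K)
    {X Y : Matrix (Fin d) (Fin n) ℝ} (hX : X ∈ Ω) (hY : Y ∈ Ω) :
    |f X - f Y| ≤ K * frobeniusNorm (X - Y) ^ γ := by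
  rcases eq_or_ne X Y with rfl | hXY
  · have := Real.rpow_nonneg (frobeniusNorm_nonneg (X - X)) γ
    simpa using mul_nonneg hK this
  · have hpos := Real.rpow_pos_of_pos (frobeniusNorm_sub_pos hXY) γ
    have h : ENNReal.ofReal (|f X - f Y| / frobeniusNorm (X - Y) ^ γ) ≤ ENNReal.ofReal K := by
      refine le_trans ?_ (le_add_self.trans hf)
      exact le_iSup₂_of_le X hX (le_iSup₂_of_le Y hY (le_iSup_of_le hXY le_rfl))
    rwa [ENNReal.ofReal_le_ofReal_iff hK, div_le_iff₀ hpos] at h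

/-- The grid point of the cell `k`. -/
noncomputable def gridPoint {d n K : ℕ} (k : Fin d → Fin n → Fin K) : Matrix (Fin d) (Fin n) ℝ :=
  Matrix.of fun i j => (k i j : ℝ) / K

theorem gridPoint_mem_unitCube {d n K : ℕ} (k : Fin d → Fin n → Fin K) :
    gridPoint k ∈ unitCube d n := fun i j => by
  have h : ((k i j : ℕ) : ℝ) ≤ K := by exact_mod_cast (k i j).2.le
  exact ⟨by simp only [gridPoint, Matrix.of_apply]; positivity,
    div_le_one_of_le₀ h (Nat.cast_nonneg _)⟩

section Holder

variable {d n : ℕ} {γ KH ε : ℝ} {f : Matrix (Fin d) (Fin n) ℝ → ℝ}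

/-- The number of cells of the grid in each direction. -/
noncomputable def gridSize (γ ε : ℝ) : ℕ := ⌊ε ^ (-(1 / γ))⌋₊

theorem gridSize_pos (hγ : 0 < γ) (hε : ε ∈ Set.Ioo (0 : ℝ) 1) : 0 < gridSize γ ε :=
  Nat.floor_pos.mpr (Real.one_le_rpow_of_pos_of_le_one_of_nonpos hε.1 hε.2.le
    (by simp [hγ.le]))

/-- Rounding K down keeps the number of cells within the width budget. -/
theorem gridSize_pow_le (hγ : 0 < γ) (hε : ε ∈ Set.Ioo (0 : ℝ) 1) (d n : ℕ) :
    gridSize γ ε ^ (d * n) ≤ ⌈ε ^ (-((d : ℝ) * (n : ℝ) / γ))⌉₊ := by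
  have h : ((gridSize γ ε : ℕ) : ℝ) ≤ ε ^ (-(1 / γ)) :=
    Nat.floor_le (Real.rpow_nonneg hε.1.le _)
  have h' : ((gridSize γ ε ^ (d * n) : ℕ) : ℝ) ≤ ε ^ (-((d : ℝ) * (n : ℝ) / γ)) := by
    push_cast
    refine (pow_le_pow_left₀ (Nat.cast_nonneg _) h _).trans_eq ?_
    rw [← Real.rpow_natCast, ← Real.rpow_mul hε.1.le]
    congr 1
    push_cast
    field_simp
  exact_mod_cast h'.trans (Nat.le_ceil _)

/-- Rounding down a number that is at least 1 loses at most a factor 2. -/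
theorem inv_gridSize_le (hγ : 0 < γ) (hε : ε ∈ Set.Ioo (0 : ℝ) 1) :
    1 / (gridSize γ ε : ℝ) ≤ 2 * ε ^ (1 / γ) := by
  have hpos : 0 < ε ^ (1 / γ) := Real.rpow_pos_of_pos hε.1 _
  have hK : (0 : ℝ) < gridSize γ ε := by exact_mod_cast gridSize_pos hγ hε
  have hK1 : (1 : ℝ) ≤ gridSize γ ε := by exact_mod_cast gridSize_pos hγ hε
  have h : ε ^ (-(1 / γ)) < gridSize γ ε + 1 := Nat.lt_floor_add_one _
  rw [Real.rpow_neg hε.1.le] at h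
  have h1 : (ε ^ (1 / γ))⁻¹ * ε ^ (1 / γ) = 1 := inv_mul_cancel₀ hpos.ne'
  rw [div_le_iff₀ hK]
  nlinarith

theorem abs_sub_gridPoint_le (hd : 0 < d) (hn : 0 < n) (hγ : γ ∈ Set.Ioc (0 : ℝ) 1)
    (hKH : 0 < KH) (hf : f ∈ holderClass (unitCube d n) γ KH) (hε : ε ∈ Set.Ioo (0 : ℝ) 1)
    {X : Matrix (Fin d) (Fin n) ℝ} (hX : X ∈ unitCube d n)
    (k : Fin d → Fin n → Fin (gridSize γ ε))
    (hk : ∀ i j, |X i j - k i j / gridSize γ ε| ≤ 3 / 2 / gridSize γ ε) :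
    |f (gridPoint k) - f X| ≤ 3 * √(d * n) * KH * ε := by
  have hd1 : (1 : ℝ) ≤ d := by exact_mod_cast hd
  have hn1 : (1 : ℝ) ≤ n := by exact_mod_cast hn
  have hs : 1 ≤ √((d : ℝ) * n) := by
    rw [Real.one_le_sqrt]
    nlinarith
  have h₁ : frobeniusNorm (X - gridPoint k) ≤ (3 * √(d * n)) * ε ^ (1 / γ) := by
    refine (frobeniusNorm_le (by positivity) hk).trans ?_
    have := inv_gridSize_le hγ.1 hε
    have h2 : 3 / 2 / (gridSize γ ε : ℝ) ≤ 3 * ε ^ (1 / γ) := by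
      rw [div_eq_mul_one_div]
      linarith
    refine (mul_le_mul_of_nonneg_left h2 (by positivity)).trans_eq ?_
    ring
  rw [abs_sub_comm]
  refine (abs_sub_le_of_mem_holderClass hKH.le hf hX (gridPoint_mem_unitCube k)).trans ?_
  have h₂ : frobeniusNorm (X - gridPoint k) ^ γ ≤ 3 * √(d * n) * ε := by
    refine (Real.rpow_le_rpow (frobeniusNorm_nonneg _) h₁ hγ.1.le).trans ?_
    rw [Real.mul_rpow (by positivity) (Real.rpow_nonneg hε.1.le _), ← Real.rpow_mul hε.1.le,
      one_div_mul_cancel hγ.1.ne', Real.rpow_one]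
    refine mul_le_mul_of_nonneg_right ?_ hε.1.le
    -- The base 3 √(dx n) is at least 1 and γ ≤ 1, so dropping the exponent only enlarges it.
    exact (Real.rpow_le_rpow_of_exponent_le (by linarith) hγ.2).trans_eq (Real.rpow_one _)
  refine (mul_le_mul_of_nonneg_left h₂ hKH.le).trans_eq ?_
  ring

/-- The essential supremum controls f only almost everywhere; the Hölder seminorm and the value at 0
give a bound everywhere. -/
theorem exists_bound_of_mem_holderClass (hγ : 0 < γ) (hKH : 0 ≤ KH)
    (hf : f ∈ holderClass (unitCube d n) γ KH) :
    ∃ B, ∀ X ∈ unitCube d n, |f X| ≤ B := by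
  have h0 : (0 : Matrix (Fin d) (Fin n) ℝ) ∈ unitCube d n := fun i j => by simp
  refine ⟨|f 0| + KH * (√(d * n) * 1) ^ γ, fun X hX => ?_⟩
  have h₁ : frobeniusNorm (X - 0) ≤ √(d * n) * 1 := by
    refine frobeniusNorm_le zero_le_one fun i j => ?_
    rw [sub_zero, abs_of_nonneg (hX i j).1]
    exact (hX i j).2
  have h₂ := abs_sub_le_of_mem_holderClass hKH hf hX h0
  have h₃ := mul_le_mul_of_nonneg_left
    (Real.rpow_le_rpow (frobeniusNorm_nonneg _) h₁ hγ.le) hKH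
  have h₄ := abs_sub_abs_le_abs_sub (f X) (f 0)
  linarith

end Holder

theorem frobeniusNorm_le_of_entries {d n : ℕ} (hd : 0 < d) (hn : 0 < n) {KH ε : ℝ} (hKH : 0 ≤ KH)
    (hε : 0 ≤ ε) {A : Matrix (Fin d) (Fin n) ℝ} (h : ∀ i j, |A i j| ≤ 3 * √(d * n) * KH * ε) :
    frobeniusNorm A ≤ 3 * ((d : ℝ) * n) ^ 2 * KH * ε := by
  have h1 : (1 : ℝ) ≤ d * n := by exact_mod_cast Nat.mul_pos hd hn
  refine (frobeniusNorm_le (by positivity) h).trans ?_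
  have h2 : √((d : ℝ) * n) * √(d * n) = d * n := Real.mul_self_sqrt (by positivity)
  calc √((d : ℝ) * n) * (3 * √(d * n) * KH * ε)
      = √((d : ℝ) * n) * √(d * n) * (3 * KH * ε) := by ring
    _ ≤ (d * n) ^ 2 * (3 * KH * ε) := by
        rw [h2]
        exact mul_le_mul_of_nonneg_right (by nlinarith) (by positivity)
    _ = _ := by ring

/-! Measure of the gaps -/

theorem unitCube_eq_pi (d n : ℕ) : unitCube d n =
    (Set.univ.pi fun _ => Set.univ.pi fun _ => Set.Icc (0 : ℝ) 1) := by
  ext X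
  exact ⟨fun h i _ j _ => h i j, fun h i j => h i (Set.mem_univ i) j (Set.mem_univ j)⟩

instance isProbabilityMeasure_restrict_Icc :
    IsProbabilityMeasure (volume.restrict (Set.Icc (0 : ℝ) 1)) := ⟨by simp⟩

theorem volume_restrict_unitCube (d n : ℕ) :
    (volume : Measure (Matrix (Fin d) (Fin n) ℝ)).restrict (unitCube d n) =
      Measure.pi fun _ => Measure.pi fun _ => volume.restrict (Set.Icc (0 : ℝ) 1) := by
  rw [unitCube_eq_pi]
  refine (Measure.restrict_pi_pi (fun _ : Fin d => (volume : Measure (Fin n → ℝ))) _).trans ?_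
  congr 1
  funext i
  exact Measure.restrict_pi_pi (fun _ : Fin n => (volume : Measure ℝ)) _

instance isProbabilityMeasure_restrict_unitCube (d n : ℕ) : IsProbabilityMeasure
    ((volume : Measure (Matrix (Fin d) (Fin n) ℝ)).restrict (unitCube d n)) := by
  rw [volume_restrict_unitCube]
  exact inferInstanceAs (IsProbabilityMeasure (Measure.pi fun _ : Fin d =>
    Measure.pi fun _ : Fin n => volume.restrict (Set.Icc (0 : ℝ) 1)))

theorem measurableSet_unitCube (d n : ℕ) : MeasurableSet (unitCube d n) := by
  rw [unitCube_eq_pi]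
  exact MeasurableSet.univ_pi fun _ => MeasurableSet.univ_pi fun _ => measurableSet_Icc

theorem measurable_entry {d n : ℕ} (i : Fin d) (j : Fin n) :
    Measurable fun X : Matrix (Fin d) (Fin n) ℝ => X i j :=
  (measurable_pi_apply j).comp (measurable_pi_apply (X := fun _ : Fin d => Fin n → ℝ) i)

theorem volume_entry_mem_le {d n : ℕ} (i : Fin d) (j : Fin n) {S : Set ℝ} (hS : MeasurableSet S) :
    (volume : Measure (Matrix (Fin d) (Fin n) ℝ)).restrict (unitCube d n) {X | X i j ∈ S} ≤
      volume S := by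
  rw [volume_restrict_unitCube]
  have h₁ := measurePreserving_eval
    (fun _ : Fin d => Measure.pi fun _ : Fin n => volume.restrict (Set.Icc (0 : ℝ) 1)) i
  have h₂ := measurePreserving_eval (fun _ : Fin n => volume.restrict (Set.Icc (0 : ℝ) 1)) j
  have h₃ := (h₂.comp h₁).measure_preimage hS.nullMeasurableSet
  exact h₃.trans_le (Measure.restrict_apply_le _ _)

/-- The entries whose embeddings fall into the gaps. -/
noncomputable def gapSet (K : ℕ) (δ : ℝ) : Set ℝ :=
  ⋃ r : Fin K, Set.Ioo (((r : ℝ) - δ) / (K - 3 * δ)) ((r : ℝ) / (K - 3 * δ))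

theorem measurableSet_gapSet (K : ℕ) (δ : ℝ) : MeasurableSet (gapSet K δ) :=
  MeasurableSet.iUnion fun _ => measurableSet_Ioo

/-- Each gap has length δ / (K - 3δ) ≤ 4δ, because K - 3δ ≥ 1/4. -/
theorem volume_gapSet_le {K : ℕ} (hK : 0 < K) {δ : ℝ} (hδ : δ ∈ Set.Ioc (0 : ℝ) (1 / 4)) :
    volume (gapSet K δ) ≤ ENNReal.ofReal (K * (4 * δ)) := by
  have hK1 : (1 : ℝ) ≤ K := by exact_mod_cast hK
  refine (measure_iUnion_le _).trans ?_
  rw [tsum_fintype]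
  refine (Finset.sum_le_sum (g := fun _ => ENNReal.ofReal (4 * δ)) fun r _ => ?_).trans ?_
  · rw [Real.volume_Ioo]
    refine ENNReal.ofReal_le_ofReal ?_
    have hα : 0 < (K : ℝ) - 3 * δ := by linarith [hδ.2]
    rw [← sub_div, div_le_iff₀ hα]
    nlinarith [hδ.1, hδ.2]
  · rw [Finset.sum_const, Finset.card_univ, Fintype.card_fin, nsmul_eq_mul,
      ENNReal.ofReal_mul (Nat.cast_nonneg K), ENNReal.ofReal_natCast]

theorem exists_lt_of_not_isFlat {δ y : ℝ} (hy : 0 < y) (h : ¬IsFlat δ y) :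
    ∃ m : ℕ, (m : ℝ) < y ∧ y < m + δ := by
  obtain ⟨m, hm⟩ : ∃ m, ⌈y⌉₊ = m + 1 :=
    Nat.exists_eq_succ_of_ne_zero (Nat.ceil_pos.mpr hy).ne'
  have h₁ : (m : ℝ) < y := Nat.lt_ceil.mp (by omega)
  have h₂ : y ≤ m + 1 := by
    have := Nat.le_ceil y
    rw [hm] at this
    exact_mod_cast this
  refine ⟨m, h₁, ?_⟩
  by_contra! h'
  exact h ⟨m, h', h₂⟩

/-- The column offset jK is an integer, so one set of gaps serves all columns. -/
theorem isFlat_of_notMem_gapSet {K : ℕ} (hK : 0 < K) {δ : ℝ} (hδ : δ ∈ Set.Ioc (0 : ℝ) (1 / 4))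
    (j : ℕ) {x : ℝ} (hx : x ∈ Set.Icc (0 : ℝ) 1) (h : x ∉ gapSet K δ) :
    IsFlat δ (embedEntry K δ 0 j x) := by
  have hK1 : (1 : ℝ) ≤ K := by exact_mod_cast hK
  have hy := embedEntry_mem_Icc hK hδ (v := 0) (by norm_num) j hx
  have hy0 : 0 < embedEntry K δ 0 j x :=
    (add_pos_of_nonneg_of_pos (by positivity) hδ.1).trans_le hy.1
  by_contra hflat
  obtain ⟨m, hm₁, hm₂⟩ := exists_lt_of_not_isFlat hy0 hflat
  have hjm : j * K ≤ m := by
    have : ((j * K : ℕ) : ℝ) < (m + 1 : ℕ) := by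
      push_cast
      linarith [hy.1, hδ.2]
    exact Nat.lt_succ_iff.mp (by exact_mod_cast this)
  have hmj : m < j * K + K := by
    have : (m : ℝ) < (j * K + K : ℕ) := by
      push_cast
      linarith [hy.2]
    exact_mod_cast this
  have hα : 0 < (K : ℝ) - 3 * δ := by linarith [hδ.2]
  refine h (Set.mem_iUnion.mpr ⟨⟨m - j * K, by omega⟩, ?_, ?_⟩)
  · rw [div_lt_iff₀ hα, Nat.cast_sub hjm]
    unfold embedEntry at hm₁
    push_cast
    linarith
  · rw [lt_div_iff₀ hα, Nat.cast_sub hjm]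
    unfold embedEntry at hm₂
    push_cast
    linarith

/-- Of the three shifts of an entry at most one falls into a gap. -/
theorem exists_forall_ne_isFlat {K : ℕ} (hK : 0 < K) {δ : ℝ} (hδ : δ ∈ Set.Ioc (0 : ℝ) (1 / 4))
    (j : ℕ) {x : ℝ} (hx : x ∈ Set.Icc (0 : ℝ) 1) :
    ∃ v₀ : Fin 3, ∀ v ≠ v₀, IsFlat δ (embedEntry K δ (v : ℕ) j x) := by
  by_cases hall : ∀ v : Fin 3, IsFlat δ (embedEntry K δ (v : ℕ) j x)
  · exact ⟨0, fun v _ => hall v⟩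
  push Not at hall
  obtain ⟨v₀, hv₀⟩ := hall
  refine ⟨v₀, fun v hv => ?_⟩
  by_contra hflat
  have hpos : ∀ v : Fin 3, 0 < embedEntry K δ (v : ℕ) j x := fun v => by
    have hv : ((v : ℕ) : ℝ) ≤ 2 := by exact_mod_cast Nat.lt_succ_iff.mp v.2
    exact (add_pos_of_nonneg_of_pos (by positivity) hδ.1).trans_le
      (embedEntry_mem_Icc hK hδ ⟨Nat.cast_nonneg _, hv⟩ j hx).1
  -- Two shifts of an entry differ by at least δ, too much for one open gap of width δ, and by at
  -- most 2δ, too little to reach the next gap.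
  have key : ∀ v v' : Fin 3, v < v' → ¬IsFlat δ (embedEntry K δ (v : ℕ) j x) →
      ¬IsFlat δ (embedEntry K δ (v' : ℕ) j x) → False := fun v v' hlt h h' => by
    obtain ⟨m, hm₁, hm₂⟩ := exists_lt_of_not_isFlat (hpos v) h
    obtain ⟨m', hm₁', hm₂'⟩ := exists_lt_of_not_isFlat (hpos v') h'
    have hv' : ((v' : ℕ) : ℝ) ≤ 2 := by exact_mod_cast Nat.lt_succ_iff.mp v'.2
    have hv : ((v : ℕ) : ℝ) + 1 ≤ (v' : ℕ) := by exact_mod_cast hlt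
    have hv0 : (0 : ℝ) ≤ (v : ℕ) := Nat.cast_nonneg _
    unfold embedEntry at hm₁ hm₂ hm₁' hm₂'
    have h₁ : (m : ℝ) < m' := by nlinarith [hδ.1, hδ.2]
    have h₂ : (m' : ℝ) < m + 1 := by nlinarith [hδ.1, hδ.2]
    have h₃ : m < m' := by exact_mod_cast h₁
    have h₄ : m' < m + 1 := by exact_mod_cast h₂
    omega
  rcases lt_or_gt_of_ne hv with h | h
  · exact key _ _ h hflat hv₀
  · exact key _ _ h hv₀ hflat

/-! The median of three shifted copies -/

/-- The median of three reals, as computed by two ReLU layers. -/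
noncomputable def median (a b c : ℝ) : ℝ :=
  a - max (a - b) 0 + max (c - (a - max (a - b) 0)) 0 - max (c - (b + max (a - b) 0)) 0

/-- The ReLU of a - b turns a and b into their minimum and maximum; the other two clamp c between
these. -/
theorem median_mem_Icc {l h : ℝ} (y : Fin 3 → ℝ) (v₀ : Fin 3)
    (hy : ∀ v ≠ v₀, y v ∈ Set.Icc l h) : median (y 0) (y 1) (y 2) ∈ Set.Icc l h := by
  unfold median
  fin_cases v₀
  · have h₁ := hy 1 (by decide)
    have h₂ := hy 2 (by decide)
    constructor <;> grind
  · have h₁ := hy 0 (by decide)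
    have h₂ := hy 2 (by decide)
    constructor <;> grind
  · have h₁ := hy 0 (by decide)
    have h₂ := hy 1 (by decide)
    constructor <;> grind

section Median

variable {Q : Type*} [Fintype Q] [DecidableEq Q] {dx n D H W : ℕ}

/-- Two layers that replace, in the copies with shift `0` in direction `q`, the state by the
median of the states of the three copies which differ in direction `q` only. -/
theorem exists_median_layers (e : (Q → Fin 3) × Fin dx ↪ Fin D)
    (hW : 2 * (3 ^ Fintype.card Q * dx) ≤ W) (q : Q) :
    ∃ l₁ l₂ : Layer D H 1 W, ∀ (Z : Matrix (Fin D) (Fin n) ℝ) s i j, s q = 0 →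
      layerMap l₂ (layerMap l₁ Z) (e (s, i)) j =
        median (Z (e (Function.update s q 0, i)) j) (Z (e (Function.update s q 1, i)) j)
          (Z (e (Function.update s q 2, i)) j) := by
  let up : (Q → Fin 3) → Fin 3 → Q → Fin 3 := fun s v => Function.update s q v
  -- Copy 0 becomes the minimum of copies 0 and 1, copy 1 their maximum, and copy 2 stays.
  obtain ⟨l₁, hl₁⟩ := exists_layer (n := n) (H := H) (W := W) e (κ := (Q → Fin 3) × Fin dx)
    (le_trans (by simp; omega) hW) 0 0 0 0
    (fun k p => (if (up k.1 0, k.2) = p then 1 else 0) - if (up k.1 1, k.2) = p then 1 else 0)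
    0 (fun k p => if k = p then (if p.1 q = 0 then -1 else if p.1 q = 1 then 1 else 0) else 0) 0
  -- This layer clamps copy 2 between the two sorted copies, with two neurons per coordinate.
  obtain ⟨l₂, hl₂⟩ := exists_layer (n := n) (H := H) (W := W) e
    (κ := Bool × ((Q → Fin 3) × Fin dx))
    (by simpa using hW) 0 0 0 0
    (fun k p => (if (up k.2.1 2, k.2.2) = p then 1 else 0) -
      if (up k.2.1 (if k.1 then 1 else 0), k.2.2) = p then 1 else 0)
    0 (fun k p => if k.2 = p then (if k.1 then -1 else 1) else 0) 0
  have h₁ : ∀ (Z : Matrix (Fin D) (Fin n) ℝ) s i j, layerMap l₁ Z (e (s, i)) j =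
      Z (e (s, i)) j + (if s q = 0 then -1 else if s q = 1 then 1 else 0) *
        max (Z (e (up s 0, i)) j - Z (e (up s 1, i)) j) 0 := fun Z s i j => by
    refine (congrFun₂ (hl₁ Z) (s, i) j).trans ?_
    rw [attentionStep_zero]
    simp only [feedForwardStep, Pi.zero_apply, add_zero, sub_mul, Finset.sum_sub_distrib,
      ite_mul, one_mul, zero_mul, Finset.sum_ite_eq, Finset.sum_ite_eq', Finset.mem_univ, if_true]
  have h₂ : ∀ (Z : Matrix (Fin D) (Fin n) ℝ) s i j, layerMap l₂ Z (e (s, i)) j =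
      Z (e (s, i)) j + max (Z (e (up s 2, i)) j - Z (e (up s 0, i)) j) 0 -
        max (Z (e (up s 2, i)) j - Z (e (up s 1, i)) j) 0 := fun Z s i j => by
    refine (congrFun₂ (hl₂ Z) (s, i) j).trans ?_
    rw [attentionStep_zero]
    simp only [feedForwardStep, Pi.zero_apply, add_zero, sub_mul, Finset.sum_sub_distrib,
      ite_mul, one_mul, zero_mul, Finset.sum_ite_eq, Finset.sum_ite_eq', Finset.mem_univ, if_true,
      Fintype.sum_prod_type (α₁ := Bool), Fintype.sum_bool]
    simp
    ring
  refine ⟨l₁, l₂, fun Z s i j hs => ?_⟩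
  have hup : ∀ v v', up (up s v) v' = up s v' := fun v v' => Function.update_idem _ _ _
  have hs0 : up s 0 = s := by rw [← hs]; exact Function.update_eq_self q s
  have hq : ∀ v, up s v q = v := fun v => Function.update_self _ _ _
  change _ = median (Z (e (up s 0, i)) j) (Z (e (up s 1, i)) j) (Z (e (up s 2, i)) j)
  rw [h₂, h₁, h₁ Z (up s 2), h₁ Z (up s 0), h₁ Z (up s 1)]
  simp only [hup, hq, hs, hs0, median]
  have h10 : (1 : Fin 3) ≠ 0 := by decide
  have h20 : (2 : Fin 3) ≠ 0 := by decide
  have h21 : (2 : Fin 3) ≠ 1 := by decide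
  simp [h10, h20, h21, sub_eq_add_neg]

/-- If in each direction at most one of the three shifts is bad, the iterated median of the
copies is as good as each copy with good shifts. -/
theorem exists_iterated_median_layers (e : (Q → Fin 3) × Fin dx ↪ Fin D)
    (hW : 2 * (3 ^ Fintype.card Q * dx) ≤ W) (qs : List Q) (hqs : qs.Nodup) :
    ∃ ls : List (Layer D H 1 W), ls.length = 2 * qs.length ∧
      ∀ (Z : Matrix (Fin D) (Fin n) ℝ) (good : Q → Fin 3 → Prop),
        (∀ q, ∃ v₀, ∀ v ≠ v₀, good q v) → ∀ i j l h,
        (∀ s : Q → Fin 3, (∀ q ∉ qs, s q = 0) → (∀ q ∈ qs, good q (s q)) →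
          Z (e (s, i)) j ∈ Set.Icc l h) →
        ls.foldl (fun Z l => layerMap l Z) Z (e (0, i)) j ∈ Set.Icc l h := by
  induction qs with
  | nil => exact ⟨[], rfl, fun Z _ _ i j l h hZ => hZ 0 (by simp) (by simp)⟩
  | cons q qs ih =>
    obtain ⟨hq, hqs⟩ := List.nodup_cons.mp hqs
    obtain ⟨ls, hlen, hls⟩ := ih hqs
    obtain ⟨l₁, l₂, hl⟩ := exists_median_layers (n := n) (H := H) e hW q
    refine ⟨l₁ :: l₂ :: ls, by simp [hlen]; ring, fun Z good hgood i j l h hZ => ?_⟩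
    -- After direction `q` only copies with shift 0 in `q` matter; each is a median of three states
    -- of which at least two satisfy the hypothesis.
    refine hls _ good hgood i j l h fun s hs0 hs => ?_
    obtain ⟨v₀, hv₀⟩ := hgood q
    change layerMap l₂ (layerMap l₁ Z) (e (s, i)) j ∈ Set.Icc l h
    rw [hl _ _ _ _ (hs0 q hq)]
    refine median_mem_Icc (fun v => Z (e (Function.update s q v, i)) j) v₀ fun v hv =>
      hZ _ (fun q' hq' => ?_) fun q' hq' => ?_
    · rw [List.mem_cons, not_or] at hq'
      rw [Function.update_of_ne hq'.1]
      exact hs0 q' hq'.2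
    · rcases eq_or_ne q' q with rfl | hne
      · rw [Function.update_self]
        exact hv₀ v hv
      · rw [Function.update_of_ne hne]
        exact hs q' ((List.mem_cons.mp hq').resolve_left hne)

end Median

/-! ### Membership in the Transformer class -/

theorem mem_transformerClass {n dx dy D H S W L : ℕ} (Ein : Matrix (Fin D) (Fin dx) ℝ)
    (P : Matrix (Fin D) (Fin n) ℝ) (Eout : Matrix (Fin dy) (Fin D) ℝ)
    (ls : List (Layer D H S W)) (hL : ls.length = L) :
    (fun X => Eout * ls.foldl (fun Z l => layerMap l Z) (Ein * X + P)) ∈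
      transformerClass n dx dy D H S W L := by
  subst hL
  refine ⟨⟨Ein, P, ls.get, Eout⟩, ?_⟩
  funext X
  simp only [Transformer.eval, List.ofFn_get]
  rfl

/-- The projection onto the coordinates `e i`. -/
def selectRows {dx D : ℕ} (e : Fin dx → Fin D) : Matrix (Fin dx) (Fin D) ℝ :=
  Matrix.of fun i r => if r = e i then 1 else 0

theorem selectRows_mul {dx D n : ℕ} (e : Fin dx → Fin D) (Z : Matrix (Fin D) (Fin n) ℝ)
    (i : Fin dx) (j : Fin n) : (selectRows e * Z) i j = Z (e i) j := by
  simp [selectRows, Matrix.mul_apply]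

theorem const_mem_transformerClass {n dx D H W L : ℕ} (h : dx ≤ D)
    (A : Matrix (Fin dx) (Fin n) ℝ) :
    (fun _ => A) ∈ transformerClass n dx dx D H 1 W L := by
  have e := Fin.castLEEmb h
  obtain ⟨l, hl⟩ := exists_layer (n := n) (H := H) (W := W) e (κ := Empty) (by simp) 0 0 0 0
    0 0 0 0
  have hl' : ∀ (Z : Matrix (Fin D) (Fin n) ℝ) i j, layerMap l Z (e i) j = Z (e i) j :=
    fun Z i j => (congrFun₂ (hl Z) i j).trans (by rw [attentionStep_zero]; simp [feedForwardStep])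
  convert mem_transformerClass (n := n) (0 : Matrix (Fin D) (Fin dx) ℝ)
    (Matrix.of (Function.extend e A 0)) (selectRows e) (List.replicate L l)
    List.length_replicate using 1
  funext X
  have hfold : ∀ (L : ℕ) (Z : Matrix (Fin D) (Fin n) ℝ) i j,
      (List.replicate L l).foldl (fun Z l => layerMap l Z) Z (e i) j = Z (e i) j := fun L => by
    induction L with
    | zero => simp
    | succ L ih =>
      intro Z i j
      rw [List.replicate_succ, List.foldl_cons, ih, hl']
  ext i j
  rw [selectRows_mul, hfold]
  rw [Matrix.zero_mul, zero_add]
  exact (congrFun (e.injective.extend_apply A 0 i) j).symm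

/-! Assembly -/

theorem matrixLpNorm_le_of_forall {d n : ℕ} {p : ℝ≥0∞} {c : ℝ}
    {G : Matrix (Fin d) (Fin n) ℝ → Matrix (Fin d) (Fin n) ℝ}
    (h : ∀ X ∈ unitCube d n, frobeniusNorm (G X) ≤ c) :
    matrixLpNorm p (unitCube d n) G ≤ ENNReal.ofReal c := by
  refine (eLpNorm_le_of_ae_bound (C := c) ?_).trans_eq (by simp)
  filter_upwards [ae_restrict_mem (measurableSet_unitCube d n)] with X hX
  rw [Real.norm_of_nonneg (frobeniusNorm_nonneg _)]
  exact h X hX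

/-- The inputs with an entry in a gap. -/
noncomputable def gapInputs (d n K : ℕ) (δ : ℝ) : Set (Matrix (Fin d) (Fin n) ℝ) :=
  ⋃ (i) (j), {X | X i j ∈ gapSet K δ}

theorem measurableSet_gapInputs (d n K : ℕ) (δ : ℝ) : MeasurableSet (gapInputs d n K δ) :=
  MeasurableSet.iUnion fun i => MeasurableSet.iUnion fun j =>
    measurable_entry i j (measurableSet_gapSet K δ)

theorem volume_gapInputs_le (d n : ℕ) {K : ℕ} (hK : 0 < K) {δ : ℝ}
    (hδ : δ ∈ Set.Ioc (0 : ℝ) (1 / 4)) :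
    (volume : Measure (Matrix (Fin d) (Fin n) ℝ)).restrict (unitCube d n) (gapInputs d n K δ) ≤
      ENNReal.ofReal (d * (n * (K * (4 * δ)))) := by
  refine (measure_iUnion_le _).trans ?_
  rw [tsum_fintype]
  refine (Finset.sum_le_sum (g := fun _ => ENNReal.ofReal (n * (K * (4 * δ))))
    fun i _ => ?_).trans ?_
  · refine (measure_iUnion_le _).trans ?_
    rw [tsum_fintype]
    refine (Finset.sum_le_sum fun j _ => (volume_entry_mem_le i j
      (measurableSet_gapSet K δ)).trans (volume_gapSet_le hK hδ)).trans ?_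
    rw [Finset.sum_const, Finset.card_univ, Fintype.card_fin, nsmul_eq_mul,
      ENNReal.ofReal_mul (Nat.cast_nonneg n), ENNReal.ofReal_natCast]
  · rw [Finset.sum_const, Finset.card_univ, Fintype.card_fin, nsmul_eq_mul,
      ENNReal.ofReal_mul (Nat.cast_nonneg d), ENNReal.ofReal_natCast]

/-- Minkowski's inequality for c plus C times the indicator of the gaps, on a cube of measure 1. -/
theorem matrixLpNorm_le_of_gap {d n K : ℕ} (hK : 0 < K) {δ : ℝ}
    (hδ : δ ∈ Set.Ioc (0 : ℝ) (1 / 4)) {p : ℝ≥0∞} (hp : 1 ≤ p) (hp' : p ≠ ∞) {c C : ℝ}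
    (hc : 0 ≤ c) (hC : 0 ≤ C) {G : Matrix (Fin d) (Fin n) ℝ → Matrix (Fin d) (Fin n) ℝ}
    (h : ∀ X ∈ unitCube d n, X ∉ gapInputs d n K δ → frobeniusNorm (G X) ≤ c)
    (h' : ∀ X ∈ unitCube d n, frobeniusNorm (G X) ≤ C) :
    matrixLpNorm p (unitCube d n) G ≤
      ENNReal.ofReal (c + C * (d * (n * (K * (4 * δ)))) ^ (1 / p.toReal)) := by
  have hp0 : p ≠ 0 := (zero_lt_one.trans_le hp).ne'
  have hm := measurableSet_gapInputs d n K δ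
  have hδ0 := hδ.1.le
  have hle : matrixLpNorm p (unitCube d n) G ≤
      eLpNorm ((fun _ => c) + (gapInputs d n K δ).indicator fun _ => C) p
        (volume.restrict (unitCube d n)) := by
    refine eLpNorm_mono_ae_real ?_
    filter_upwards [ae_restrict_mem (measurableSet_unitCube d n)] with X hX
    rw [Real.norm_of_nonneg (frobeniusNorm_nonneg _), Pi.add_apply]
    by_cases hXg : X ∈ gapInputs d n K δ
    · rw [Set.indicator_of_mem hXg]
      linarith [h' X hX]
    · rw [Set.indicator_of_notMem hXg]
      linarith [h X hX hXg]
  refine hle.trans ((eLpNorm_add_le aestronglyMeasurable_const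
    (aestronglyMeasurable_const.indicator hm) hp).trans ?_)
  rw [eLpNorm_indicator_const hm hp0 hp', eLpNorm_const' _ hp0 hp', measure_univ,
    ENNReal.one_rpow, mul_one, ENNReal.ofReal_add hc (by positivity), ENNReal.ofReal_mul hC,
    Real.enorm_of_nonneg hc, Real.enorm_of_nonneg hC,
    ← ENNReal.ofReal_rpow_of_nonneg (by positivity) (by positivity)]
  gcongr
  exact volume_gapInputs_le d n hK hδ

theorem exists_gap_width (a C η q : ℝ) (hη : 0 < η) (hq : 0 < q) :
    ∃ δ ∈ Set.Ioc (0 : ℝ) (1 / 4), C * (a * δ) ^ q ≤ η := by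
  have hcont : Tendsto (fun δ : ℝ => C * (a * δ) ^ q) (𝓝[>] 0) (𝓝 (C * (a * 0) ^ q)) := by
    refine Tendsto.mono_left ?_ nhdsWithin_le_nhds
    refine ContinuousAt.tendsto (f := fun δ : ℝ => C * (a * δ) ^ q) ?_
    exact continuousAt_const.mul ((continuousAt_const.mul continuousAt_id).rpow_const
      (Or.inr hq.le))
  rw [mul_zero, Real.zero_rpow hq.ne', mul_zero] at hcont
  have h₁ := hcont.eventually_le_const hη
  have h₂ : ∀ᶠ δ : ℝ in 𝓝[>] 0, δ ∈ Set.Ioc (0 : ℝ) (1 / 4) :=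
    Ioc_mem_nhdsGT (by norm_num)
  obtain ⟨δ, hδ₁, hδ₂⟩ := (h₁.and h₂).exists
  exact ⟨δ, hδ₂, hδ₁⟩

/-- With K = 1 this fails for `dx > 1`, so the single-cell grid is treated apart. -/
theorem mul_le_pow_mul {dx n K : ℕ} (hdx : 0 < dx) (hn : 0 < n) (hK : 2 ≤ K) :
    dx * K ≤ K ^ (dx * n) := by
  obtain ⟨m, rfl⟩ : ∃ m, dx = m + 1 := ⟨dx - 1, by omega⟩
  have h : m + 1 ≤ K ^ m := Nat.lt_pow_self (by omega)
  calc (m + 1) * K ≤ K ^ m * K := Nat.mul_le_mul_right K h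
    _ = K ^ (m + 1) := (pow_succ K m).symm
    _ ≤ K ^ ((m + 1) * n) := Nat.pow_le_pow_right (by omega) (Nat.le_mul_of_pos_right _ hn)

theorem quantizer_width_le {dx n K M : ℕ} (hdx : 0 < dx) (hn : 0 < n) (hK : 2 ≤ K)
    (hM : K ^ (dx * n) ≤ M) : dx * (2 * (n * K) + 1) ≤ 5 * n * M := by
  have h := (mul_le_pow_mul hdx hn hK).trans hM
  have h₁ : dx * 1 ≤ n * (dx * K) := by
    rw [mul_left_comm]
    exact Nat.mul_le_mul_left dx (Nat.mul_pos hn (by omega))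
  have h₂ : n * (dx * K) ≤ n * M := Nat.mul_le_mul_left n h
  nlinarith

section Approximation

variable {dx n : ℕ} {γ KH ε : ℝ} {F : Matrix (Fin dx) (Fin n) ℝ → Matrix (Fin dx) (Fin n) ℝ}

theorem exists_const_approx (hdx : 0 < dx) (hn : 0 < n) (hγ : γ ∈ Set.Ioc (0 : ℝ) 1)
    (hKH : 0 < KH) (hF : ∀ i j, (fun X => F X i j) ∈ holderClass (unitCube dx n) γ KH)
    (hε : ε ∈ Set.Ioo (0 : ℝ) 1) (hK : gridSize γ ε = 1) :
    ∃ A : Matrix (Fin dx) (Fin n) ℝ, ∀ X ∈ unitCube dx n,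
      frobeniusNorm (A - F X) ≤ 4 * ((dx : ℝ) * n) ^ 2 * KH * ε := by
  refine ⟨F (gridPoint fun _ _ => (⟨0, gridSize_pos hγ.1 hε⟩ : Fin (gridSize γ ε))),
    fun X hX => ?_⟩
  refine (frobeniusNorm_le_of_entries hdx hn hKH.le hε.1.le fun i j =>
    abs_sub_gridPoint_le hdx hn hγ hKH (hF i j) hε hX _ fun i j => ?_).trans ?_
  · have h := hX i j
    change |X i j - ((0 : ℕ) : ℝ) / gridSize γ ε| ≤ _
    rw [hK, abs_le]
    constructor <;> norm_num <;> linarith [h.1, h.2]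
  · have := hKH
    have := hε.1
    gcongr
    norm_num

theorem exists_approx_Lp (hdx : 0 < dx) (hn : 0 < n) (hγ : γ ∈ Set.Ioc (0 : ℝ) 1)
    (hKH : 0 < KH) (hF : ∀ i j, (fun X => F X i j) ∈ holderClass (unitCube dx n) γ KH)
    (hε : ε ∈ Set.Ioo (0 : ℝ) 1) {p : ℝ≥0∞} (hp : 1 ≤ p) (hp' : p ≠ ∞)
    (hK : 2 ≤ gridSize γ ε) {M : ℕ} (hM : gridSize γ ε ^ (dx * n) ≤ M) :
    ∃ N ∈ transformerClass n dx dx dx 1 1 (5 * n * M) 2,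
      matrixLpNorm p (unitCube dx n) (fun X => N X - F X) ≤
        ENNReal.ofReal (4 * ((dx : ℝ) * (n : ℝ)) ^ 2 * KH * ε) := by
  have : NeZero dx := ⟨hdx.ne'⟩
  have hK0 : 0 < gridSize γ ε := by omega
  have hε0 := hε.1
  obtain ⟨B, hB⟩ := exists_shifted_networks hK0
    fun k : Fin dx → Fin n → Fin (gridSize γ ε) => F (gridPoint k)
  choose BF hBF using fun i j => exists_bound_of_mem_holderClass hγ.1 hKH.le (hF i j)
  set C : ℝ := √(dx * n) * (|B| + ∑ i, ∑ j, |BF i j|)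
  have hd0 : (0 : ℝ) < (dx : ℝ) * n := by exact_mod_cast Nat.mul_pos hdx hn
  -- Three quarters of the allowed error are spent off the gaps; the gaps get the last quarter.
  obtain ⟨δ, hδ, hCδ⟩ := exists_gap_width (dx * (n * (gridSize γ ε * 4))) C
    (((dx : ℝ) * n) ^ 2 * KH * ε) (1 / p.toReal) (by positivity)
    (one_div_pos.mpr (ENNReal.toReal_pos (zero_lt_one.trans_le hp).ne' hp'))
  let e : Fin 1 × Fin dx ↪ Fin dx := ⟨Prod.snd, fun p q h => Prod.ext (Subsingleton.elim _ _) h⟩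
  obtain ⟨Ein, P, l₁, l₂, hN⟩ := hB δ hδ e (W := 5 * n * M)
    (by simpa using quantizer_width_le hdx hn hK hM) (by nlinarith) (fun _ _ _ => 0)
    (fun _ _ _ => by norm_num)
  refine ⟨_, mem_transformerClass Ein P (selectRows fun i => e (0, i)) [l₁, l₂] rfl, ?_⟩
  refine (matrixLpNorm_le_of_gap hK0 hδ hp hp' (c := 3 * ((dx : ℝ) * n) ^ 2 * KH * ε) (C := C)
    (by positivity) (by positivity) (fun X hX hgap => ?_) fun X hX => ?_).trans ?_
  · refine frobeniusNorm_le_of_entries hdx hn hKH.le hε0.le fun i j => ?_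
    obtain ⟨k, hk, hk'⟩ := (hN X hX 0).2 fun i j => isFlat_of_notMem_gapSet hK0 hδ j (hX i j)
      fun h => hgap (Set.mem_iUnion₂.mpr ⟨i, j, h⟩)
    rw [Matrix.sub_apply, selectRows_mul, List.foldl_cons, List.foldl_cons, List.foldl_nil, hk']
    exact abs_sub_gridPoint_le hdx hn hγ hKH (hF i j) hε hX k hk
  · refine frobeniusNorm_le (by positivity) fun i j => ?_
    rw [Matrix.sub_apply, selectRows_mul, List.foldl_cons, List.foldl_cons, List.foldl_nil]
    refine (abs_sub _ _).trans (add_le_add (((hN X hX 0).1 i j).trans (le_abs_self B)) ?_)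
    refine ((hBF i j X hX).trans (le_abs_self _)).trans ?_
    refine (Finset.single_le_sum (f := fun j => |BF i j|) (fun j _ => abs_nonneg _)
      (Finset.mem_univ j)).trans ?_
    exact Finset.single_le_sum (f := fun i => ∑ j, |BF i j|)
      (fun i _ => Finset.sum_nonneg fun j _ => abs_nonneg _) (Finset.mem_univ i)
  · refine ENNReal.ofReal_le_ofReal ?_
    have h : (dx : ℝ) * (n * (gridSize γ ε * 4)) * δ = dx * (n * (gridSize γ ε * (4 * δ))) := by
      ring
    rw [h] at hCδ
    linarith

theorem exists_approx_uniform (hdx : 0 < dx) (hn : 0 < n) (hγ : γ ∈ Set.Ioc (0 : ℝ) 1)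
    (hKH : 0 < KH) (hF : ∀ i j, (fun X => F X i j) ∈ holderClass (unitCube dx n) γ KH)
    (hε : ε ∈ Set.Ioo (0 : ℝ) 1) (hK : 2 ≤ gridSize γ ε) {M : ℕ}
    (hM : gridSize γ ε ^ (dx * n) ≤ M) :
    ∃ N ∈ transformerClass n dx dx (5 * dx * 3 ^ (dx * n)) (3 ^ (dx * n)) 1
        (5 * n * 3 ^ (dx * n) * M) (2 + 2 * (dx * n)),
      ∀ X ∈ unitCube dx n, frobeniusNorm (N X - F X) ≤ 4 * ((dx : ℝ) * n) ^ 2 * KH * ε := by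
  have : NeZero dx := ⟨hdx.ne'⟩
  have hK0 : 0 < gridSize γ ε := by omega
  have hε0 := hε.1
  obtain ⟨B, hB⟩ := exists_shifted_networks hK0
    fun k : Fin dx → Fin n → Fin (gridSize γ ε) => F (gridPoint k)
  have hcard : Fintype.card (Fin dx × Fin n → Fin 3) = 3 ^ (dx * n) := by simp
  let σ : (Fin dx × Fin n → Fin 3) ≃ Fin (3 ^ (dx * n)) := Fintype.equivFinOfCardEq hcard
  obtain ⟨e⟩ : Nonempty (Fin (3 ^ (dx * n)) × Fin dx ↪ Fin (5 * dx * 3 ^ (dx * n))) :=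
    Function.Embedding.nonempty_of_card_le (by
      simp only [Fintype.card_prod, Fintype.card_fin]
      nlinarith [Nat.zero_le (dx * 3 ^ (dx * n))])
  let e' : (Fin dx × Fin n → Fin 3) × Fin dx ↪ Fin (5 * dx * 3 ^ (dx * n)) :=
    (σ.prodCongr (Equiv.refl _)).toEmbedding.trans e
  -- The medians correct every input, so δ need not be small.
  have hδ : (1 / 4 : ℝ) ∈ Set.Ioc (0 : ℝ) (1 / 4) := by norm_num
  have hwidth := quantizer_width_le hdx hn hK hM
  have hscale : ∀ {a b : ℕ}, a ≤ 5 * n * b → 3 ^ (dx * n) * a ≤ 5 * n * 3 ^ (dx * n) * b :=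
    fun {a b} h => by
      calc 3 ^ (dx * n) * a ≤ 3 ^ (dx * n) * (5 * n * b) := Nat.mul_le_mul_left _ h
        _ = _ := by ring
  obtain ⟨Ein, P, l₁, l₂, hN⟩ := hB (1 / 4) hδ e (W := 5 * n * 3 ^ (dx * n) * M)
    (by rw [mul_assoc]; exact hscale hwidth) (hscale (by nlinarith))
    (fun s i j => ((σ.symm s (i, j) : Fin 3) : ℕ)) fun s i j =>
      ⟨Nat.cast_nonneg _, by exact_mod_cast Nat.lt_succ_iff.mp (σ.symm s (i, j)).2⟩
  obtain ⟨ls, hlen, hls⟩ := exists_iterated_median_layers (n := n) (H := 3 ^ (dx * n)) e'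
    (W := 5 * n * 3 ^ (dx * n) * M)
    (by
      rw [Fintype.card_prod, Fintype.card_fin, Fintype.card_fin, mul_left_comm]
      refine hscale (le_trans ?_ hwidth)
      have : 1 ≤ n * gridSize γ ε := Nat.mul_pos hn hK0
      nlinarith)
    Finset.univ.toList (Finset.nodup_toList (Finset.univ : Finset (Fin dx × Fin n)))
  refine ⟨_, mem_transformerClass Ein P (selectRows fun i => e' (0, i)) (l₁ :: l₂ :: ls)
    (by simp [hlen]; ring), fun X hX => ?_⟩
  refine (frobeniusNorm_le_of_entries hdx hn hKH.le hε0.le fun i j => ?_).trans (by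
    gcongr
    norm_num)
  rw [Matrix.sub_apply, selectRows_mul, List.foldl_cons, List.foldl_cons]
  -- Good copies may choose different cells, but all their values lie in the same interval around `F
  -- X i j`, which the medians preserve.
  have := hls (layerMap l₂ (layerMap l₁ (Ein * X + P)))
    (fun q v => IsFlat (1 / 4) (embedEntry (gridSize γ ε) (1 / 4) (v : ℕ) q.2 (X q.1 q.2)))
    (fun q => exists_forall_ne_isFlat hK0 hδ q.2 (hX q.1 q.2)) i j
    (F X i j - 3 * √(dx * n) * KH * ε) (F X i j + 3 * √(dx * n) * KH * ε) fun s _ hs => ?_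
  · rw [abs_le]
    constructor <;> linarith [this.1, this.2]
  · obtain ⟨k, hk, hk'⟩ := (hN X hX (σ s)).2 fun i j => by
      rw [σ.symm_apply_apply]
      exact hs (i, j) (by simp)
    change layerMap l₂ (layerMap l₁ (Ein * X + P)) (e (σ s, i)) j ∈ _
    rw [hk']
    have := abs_le.mp (abs_sub_gridPoint_le hdx hn hγ hKH (hF i j) hε hX k hk)
    constructor <;> linarith [this.1, this.2]

end Approximation

end TransformerApprox

theorem theorem1 (dx n : ℕ) (hdx : 0 < dx) (hn : 0 < n)
    (γ : ℝ) (hγ : γ ∈ Set.Ioc (0 : ℝ) 1) (KH : ℝ) (hKH : 0 < KH)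
    (F : Matrix (Fin dx) (Fin n) ℝ → Matrix (Fin dx) (Fin n) ℝ)
    (hF : ∀ i j, (fun X => F X i j) ∈ holderClass (unitCube dx n) γ KH)
    (ε : ℝ) (hε : ε ∈ Set.Ioo (0 : ℝ) 1) (p : ℝ≥0∞) (hp : 1 ≤ p) :
    (p ≠ ∞ →
      ∃ N ∈ transformerClass n dx dx dx 1 1
          (5 * n * ⌈ε ^ (-((dx : ℝ) * (n : ℝ) / γ))⌉₊) 2,
        matrixLpNorm p (unitCube dx n) (fun X => N X - F X) ≤
          ENNReal.ofReal (4 * ((dx : ℝ) * (n : ℝ)) ^ 2 * KH * ε)) ∧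
    (p = ∞ →
      ∃ N ∈ transformerClass n dx dx (5 * dx * 3 ^ (dx * n)) (3 ^ (dx * n)) 1
          (5 * n * 3 ^ (dx * n) * ⌈ε ^ (-((dx : ℝ) * (n : ℝ) / γ))⌉₊) (2 + 2 * (dx * n)),
        matrixLpNorm p (unitCube dx n) (fun X => N X - F X) ≤
          ENNReal.ofReal (4 * ((dx : ℝ) * (n : ℝ)) ^ 2 * KH * ε)) := by
  have hM := gridSize_pow_le hγ.1 hε dx n
  rcases (Nat.succ_le_of_lt (gridSize_pos hγ.1 hε)).eq_or_lt with hK | hK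
  · obtain ⟨A, hA⟩ := exists_const_approx hdx hn hγ hKH hF hε hK.symm
    refine ⟨fun _ => ⟨_, const_mem_transformerClass le_rfl A, matrixLpNorm_le_of_forall hA⟩,
      fun _ => ⟨_, const_mem_transformerClass ?_ A, matrixLpNorm_le_of_forall hA⟩⟩
    nlinarith [Nat.one_le_pow (dx * n) 3 (by norm_num)]
  · refine ⟨fun hp' => exists_approx_Lp hdx hn hγ hKH hF hε hp hp' hK hM, fun _ => ?_⟩
    obtain ⟨N, hN, h⟩ := exists_approx_uniform hdx hn hγ hKH hF hε hK hM
    exact ⟨N, hN, matrixLpNorm_le_of_forall h⟩
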